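/- For a finite simple graph $G$ with vertex set $V(G)$ and edge set $E(G)$, let $d(v)$ denote the degree of a vertex $v$, and for real $\alpha$ let $$\chi_\alpha(G)=\sum_{uv\in E(G)}\bigl(d(u)+d(v)\bigr)^{\alpha}$$ be the general sum-connectivity index of $G$. A graph is unicyclic if it is connected and contains exactly one cycle. Attaching a path of length $r\ge 1$ to a vertex $v$ of a graph means adding $r$ new vertices $x_1,\dots,x_r$ and the edges $vx_1,x_1x_2,\dots,x_{r-1}x_r$; for $r=1$ one says that a pendant vertex is attached. For integers $n,\Delta$ with $\frac{n+2}{2}\le\Delta\le n-1$, let $U_{n,\Delta}$ be the graph obtained by attaching $2\Delta-n-1$ pendant vertices and $n-\Delta-1$ paths of length two to the same vertex of a triangle. **Theorem.** Let $G$ be a unicyclic graph with $n$ vertices and maximum degree $\Delta$ (so $2\le\Delta\le n-1$), and let $-1\le\alpha<0$. 1. If $\frac{n+2}{2}\le\Delta\le n-1$, then $$\chi_\alpha(G)\le (n-\Delta-1)3^\alpha+(n-\Delta+1)(\Delta+2)^\alpha+(2\Delta-n-1)(\Delta+1)^\alpha+4^\alpha,$$ with equality if and only if $G$ is isomorphic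 to $U_{n,\Delta}$. 2. If $2\le\Delta\le\frac{n+1}{2}$, then $$\chi_\alpha(G)\le (\Delta-2)3^\alpha+\Delta(\Delta+2)^\alpha+(n-2\Delta+2)4^\alpha,$$ with equality if and only if $G$ is isomorphic to a graph obtained from a cycle (of some length $l\ge 3$) by attaching $\Delta-2$ paths, each of length at least two, to one fixed vertex of the cycle. -/

import Mathlib

/-- The general sum-connectivity index `χ_α(G) = ∑_{uv ∈ E(G)} (d(u) + d(v))^α`. -/
noncomputable def sumConnectivityIndex {V : Type*} [Fintype V] [DecidableEq V]
    (G : SimpleGraph V) [DecidableRel G.Adj] (α : ℝ) : ℝ :=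
  ∑ e ∈ G.edgeFinset,
    Sym2.lift ⟨fun u v => ((G.degree u : ℝ) + (G.degree v : ℝ)) ^ α,
      fun u v => congrArg (fun x : ℝ => x ^ α) (add_comm _ _)⟩ e

/-- A graph is unicyclic if it is connected and contains exactly one cycle,
cycles being identified with the subgraphs that they trace out. -/
def IsUnicyclic {V : Type*} (G : SimpleGraph V) : Prop :=
  G.Connected ∧
    ∃! C : G.Subgraph, ∃ (u : V) (p : G.Walk u u), p.IsCycle ∧ p.toSubgraph = C

/-- The graph obtained from `H` by attaching, for every `i : ι`, a path on `r i` new vertices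
to the vertex `w`: the path `P_{r i}` has the vertices `⟨i, 0⟩, …, ⟨i, r i - 1⟩`, and its terminal
vertex `⟨i, 0⟩` is joined to `w`. For `r i = 1` this attaches a pendant vertex. -/
def attachPaths {W ι : Type*} (H : SimpleGraph W) (w : W) (r : ι → ℕ) :
    SimpleGraph (W ⊕ (Σ i : ι, Fin (r i))) where
  Adj
    | .inl a, .inl b => H.Adj a b
    | .inl a, .inr q => a = w ∧ (q.2 : ℕ) = 0
    | .inr q, .inl a => a = w ∧ (q.2 : ℕ) = 0
    | .inr q, .inr q' =>
        q.1 = q'.1 ∧ ((q.2 : ℕ) + 1 = (q'.2 : ℕ) ∨ (q'.2 : ℕ) + 1 = (q.2 : ℕ))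
  symm := by
    constructor
    rintro (a | q) (b | q') h
    · exact H.adj_symm h
    · exact h
    · exact h
    · exact ⟨h.1.symm, h.2.symm⟩
  loopless := by
    constructor
    rintro (a | q) h
    · exact H.irrefl h
    · rcases h.2 with h | h <;> omega

/-- `U_{n,Δ}`, for `(n + 2) / 2 ≤ Δ ≤ n - 1`: the graph obtained by attaching `2Δ - n - 1` pendant
vertices and `n - Δ - 1` paths of length two (each with two new vertices) to the same vertex of a
triangle. -/
def extremalU (n Δ : ℕ) :=
  attachPaths (SimpleGraph.cycleGraph 3) 0
    (Sum.elim (fun _ : Fin (2 * Δ - n - 1) => 1) (fun _ : Fin (n - Δ - 1) => 2))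

/-- `G` is obtained (up to isomorphism) from a cycle `C_l`, `l ≥ 3`, by attaching `k` paths of
length at least two (each with at least two new vertices) to one vertex `w` of the cycle. -/
def IsCycleWithLongPaths {V : Type*} (G : SimpleGraph V) (k : ℕ) : Prop :=
  ∃ l : ℕ, 3 ≤ l ∧ ∃ (w : Fin l) (r : Fin k → ℕ), (∀ i, 2 ≤ r i) ∧
    Nonempty (G ≃g attachPaths (SimpleGraph.cycleGraph l) w r)

/-! Root `G` at a vertex `w` of degree `Δ` along a breadth-first tree. Since there are as many edges
as vertices, exactly one edge `xy` lies outside the tree, and it avoids `w`.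

Compare every edge with the weight `4 ^ α`. Since `∑ (d(v) - 2) = 0`, the number of leaves is the
sum of `d(u) - 2` over the vertices of degree at least three. So the surplus `3 ^ α - 4 ^ α`
allotted to each leaf edge can be charged to those vertices, `d(u) - 2` times to `u`. After this
charge each edge from `u` to a child loses at least `4 ^ α - (d(u) + 2) ^ α` (`childGain_le`). A
vertex `u ≠ w` of degree at least three has `d(u) - 1` children, and concavity of `t ↦ t ^ (-α)`,
which needs `-1 ≤ α < 0`, makes its balance negative (`excess_neg`). The vertices `x` and `y` have
one child fewer and draw on the loss at `xy` instead (`excess_lt_lossShare`). Hence vertices other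
than `w` contribute nothing positive in total, and zero only if they all have degree at most two
(`remainder_nonpos`). What is left is `indexBound`, a function of `n`, `Δ` and the number `k` of
pendant neighbours of `w`.

For `Δ > 2` this bound decreases strictly in `k`, and both `k ≥ 0` and `k ≥ 2Δ - n - 1` hold
(`two_mul_degree_le`); these give the two parts. For `Δ = 2` it does not depend on `k`. In the
equality case the branches at `w` are paths, two of which `xy` closes to a cycle
(`exists_iso_attachPaths`), and the extremal `k` restricts the lengths of the others. The converse
applies the equality clause of the same bound at the attaching vertex, so the index is never summed
by hand. -/

open Finset

/-! ### Edge count and breadth-first rootings. -/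

theorem IsUnicyclic.card_edgeFinset {V : Type*} [Fintype V] [DecidableEq V] {G : SimpleGraph V}
    [DecidableRel G.Adj] (hG : IsUnicyclic G) : #G.edgeFinset = Fintype.card V := by
  obtain ⟨hc, C, ⟨u, p, hp, rfl⟩, huniq⟩ := hG
  obtain ⟨e, he⟩ := List.exists_mem_of_ne_nil p.edges (by
    intro h
    have := hp.three_le_length
    rw [← SimpleGraph.Walk.length_edges, h] at this
    simp at this)
  have heG : e ∈ G.edgeSet := p.edges_subset_edgeSet he
  have hb : ¬ G.IsBridge e := fun h => h.notMem_edges_of_isCycle hp he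
  have hconn : (G.deleteEdges {e}).Connected := by
    obtain ⟨a, b⟩ := e
    exact hc.connected_delete_edge_of_not_isBridge hb
  have hle : G.deleteEdges {e} ≤ G := G.deleteEdges_le _
  have htree : (G.deleteEdges {e}).IsTree := by
    -- A cycle surviving the deletion of `e` would trace out the unique cycle of `G`, which contains
    -- `e`.
    refine ⟨hconn, fun v q hq => ?_⟩
    have h1 := huniq _ ⟨v, q.mapLe hle, (SimpleGraph.Walk.isCycle_mapLe hle).2 hq, rfl⟩
    have h2 : e ∈ (q.mapLe hle).edges := by
      rw [← SimpleGraph.Walk.mem_edges_toSubgraph, h1, SimpleGraph.Walk.mem_edges_toSubgraph]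
      exact he
    rw [SimpleGraph.Walk.edges_mapLe_eq_edges] at h2
    have := q.edges_subset_edgeSet h2
    simp [SimpleGraph.edgeSet_deleteEdges] at this
  have h3 := htree.card_edgeFinset
  have h4 : (G.deleteEdges {e}).edgeFinset = G.edgeFinset.erase e := by
    ext f
    simp [SimpleGraph.edgeSet_deleteEdges, and_comm]
  rw [h4, card_erase_of_mem (by simpa using heG)] at h3
  have : 0 < #G.edgeFinset := card_pos.2 ⟨e, by simpa using heG⟩
  omega

/-- A rooting of a graph at `w`: every other vertex has a parent, joined to it by an edge, and
besides these edges there is exactly one more edge `xy`, which avoids the root. -/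
structure UnicyclicRooting {V : Type*} (G : SimpleGraph V) (w : V) where
  depth : V → ℕ
  parent : V → V
  x : V
  y : V
  depth_root : depth w = 0
  adj_parent : ∀ v, v ≠ w → G.Adj v (parent v)
  depth_eq : ∀ v, v ≠ w → depth v = depth (parent v) + 1
  x_ne : x ≠ w
  y_ne : y ≠ w
  adj_xy : G.Adj x y
  parent_x_ne : parent x ≠ y
  parent_y_ne : parent y ≠ x
  adj_cases : ∀ u v, G.Adj u v → (u ≠ w ∧ parent u = v) ∨ (v ≠ w ∧ parent v = u) ∨
    (u = x ∧ v = y) ∨ (u = y ∧ v = x)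

namespace UnicyclicRooting

variable {V : Type*} {G : SimpleGraph V} {w : V}

theorem parent_eq_root (R : UnicyclicRooting G w) {v : V} (h : G.Adj w v) : R.parent v = w := by
  rcases R.adj_cases w v h with h | h | h | h
  · exact absurd rfl h.1
  · exact h.2
  · exact absurd h.1.symm R.x_ne
  · exact absurd h.1.symm R.y_ne

theorem parent_injOn (R : UnicyclicRooting G w) {u v : V} (hu : u ≠ w) (hv : v ≠ w)
    (h : s(u, R.parent u) = s(v, R.parent v)) : u = v := by
  rcases Sym2.eq_iff.1 h with h | h
  · exact h.1
  · have h1 := R.depth_eq u hu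
    have h2 := R.depth_eq v hv
    rw [h.2] at h1
    rw [← h.1] at h2
    omega

theorem depth_ne_zero (R : UnicyclicRooting G w) {v : V} (hv : v ≠ w) : R.depth v ≠ 0 := by
  rw [R.depth_eq v hv]; omega

theorem edge_ne (R : UnicyclicRooting G w) (v : V) : s(v, R.parent v) ≠ s(R.x, R.y) := by
  intro h
  rcases Sym2.eq_iff.1 h with h | h
  · exact R.parent_x_ne (h.1 ▸ h.2)
  · exact R.parent_y_ne (h.1 ▸ h.2)

theorem edgeFinset_eq [Fintype V] [DecidableEq V] [DecidableRel G.Adj]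
    (R : UnicyclicRooting G w) :
    G.edgeFinset = insert s(R.x, R.y) ((univ.erase w).image fun v => s(v, R.parent v)) := by
  ext e
  induction e with
  | h u v =>
  simp only [SimpleGraph.mem_edgeFinset, SimpleGraph.mem_edgeSet, mem_insert, mem_image, mem_erase,
    mem_univ, and_true]
  constructor
  · intro h
    rcases R.adj_cases u v h with h | h | h | h
    · exact Or.inr ⟨u, h.1, by rw [h.2]⟩
    · exact Or.inr ⟨v, h.1, by rw [h.2, Sym2.eq_swap]⟩
    · left; rw [h.1, h.2]
    · left; rw [h.1, h.2, Sym2.eq_swap]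
  · rintro (h | ⟨a, ha, h⟩)
    · rw [← SimpleGraph.mem_edgeSet, h]; exact R.adj_xy
    · rw [← SimpleGraph.mem_edgeSet, ← h]; exact R.adj_parent a ha

theorem sum_edgeFinset [Fintype V] [DecidableEq V] [DecidableRel G.Adj]
    (R : UnicyclicRooting G w) (F : Sym2 V → ℝ) :
    ∑ e ∈ G.edgeFinset, F e = F s(R.x, R.y) + ∑ v ∈ univ.erase w, F s(v, R.parent v) := by
  rw [R.edgeFinset_eq, sum_insert, sum_image]
  · intro u hu v hv h
    exact R.parent_injOn (by simpa using hu) (by simpa using hv) h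
  · simp only [mem_image, not_exists, not_and]
    exact fun v _ => R.edge_ne v

end UnicyclicRooting

theorem SimpleGraph.Connected.exists_adj_dist_eq {V : Type*} {G : SimpleGraph V}
    (hG : G.Connected) {w v : V} (hv : v ≠ w) :
    ∃ u, G.Adj v u ∧ G.dist w v = G.dist w u + 1 := by
  obtain ⟨p, hp⟩ := hG.exists_walk_length_eq_dist v w
  cases p with
  | nil => exact absurd rfl hv
  | @cons _ u _ h q =>
    refine ⟨u, h, ?_⟩
    rw [SimpleGraph.Walk.length_cons] at hp
    have h1 := SimpleGraph.dist_le q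
    have h2 : G.dist v w ≤ G.dist v u + G.dist u w := hG.dist_triangle
    rw [SimpleGraph.dist_eq_one_iff_adj.2 h] at h2
    rw [G.dist_comm (u := w), G.dist_comm (u := w)]
    omega

theorem exists_unicyclicRooting {V : Type*} [Fintype V] [DecidableEq V] {G : SimpleGraph V}
    [DecidableRel G.Adj] (hG : G.Connected) (hE : #G.edgeFinset = Fintype.card V) (w : V) :
    Nonempty (UnicyclicRooting G w) := by
  have hex : ∀ v, ∃ u, v ≠ w → G.Adj v u ∧ G.dist w v = G.dist w u + 1 := by
    intro v
    by_cases hv : v = w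
    · exact ⟨v, fun h => absurd hv h⟩
    · obtain ⟨u, hu⟩ := hG.exists_adj_dist_eq hv
      exact ⟨u, fun _ => hu⟩
  choose p hp using hex
  set T := (univ.erase w).image fun v => s(v, p v) with hT
  have hTE : T ⊆ G.edgeFinset := by
    intro e he
    obtain ⟨v, hv, rfl⟩ := mem_image.1 he
    simpa using (hp v (by simpa using hv)).1
  have hcT : #T + 1 = Fintype.card V := by
    rw [hT, card_image_of_injOn, card_erase_of_mem (mem_univ _), card_univ]
    · have : 0 < Fintype.card V := Fintype.card_pos_iff.2 ⟨w⟩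
      omega
    · intro u hu v hv h
      have h1 := (hp u (by simpa using hu)).2
      have h2 := (hp v (by simpa using hv)).2
      rcases Sym2.eq_iff.1 h with h | h
      · exact h.1
      · rw [h.2] at h1
        rw [← h.1] at h2
        omega
  have hone : #(G.edgeFinset \ T) = 1 := by
    rw [card_sdiff_of_subset hTE]; omega
  obtain ⟨e, he⟩ := card_eq_one.1 hone
  have hmem : ∀ f, f ∈ G.edgeSet → f ∉ T → f = e := by
    intro f hf hfT
    have : f ∈ G.edgeFinset \ T := by simpa [hfT] using hf
    rw [he] at this
    simpa using this
  have heE : e ∈ G.edgeFinset \ T := by rw [he]; simp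
  rw [mem_sdiff, SimpleGraph.mem_edgeFinset] at heE
  obtain ⟨heG, heT⟩ := heE
  -- A neighbour of `w` is at distance one, so its chosen parent is at distance zero. This keeps the
  -- extra edge away from the root.
  have hroot : ∀ v, G.Adj w v → s(w, v) ∈ T := by
    intro v hv
    refine mem_image.2 ⟨v, by simpa using hv.ne', ?_⟩
    have h1 := (hp v hv.ne').2
    rw [SimpleGraph.dist_eq_one_iff_adj.2 hv] at h1
    have h2 : G.dist w (p v) = 0 := by omega
    rw [hG.dist_eq_zero_iff] at h2
    rw [← h2, Sym2.eq_swap]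
  induction e with
  | h x y =>
  have hx : x ≠ w := by
    rintro rfl; exact heT (hroot y heG)
  have hy : y ≠ w := by
    rintro rfl; exact heT (by rw [Sym2.eq_swap]; exact hroot x heG.symm)
  refine ⟨⟨G.dist w, p, x, y, by simp, fun v hv => (hp v hv).1, fun v hv => (hp v hv).2,
    hx, hy, heG, ?_, ?_, ?_⟩⟩
  · intro h
    exact heT (mem_image.2 ⟨x, by simpa using hx, by rw [h]⟩)
  · intro h
    exact heT (mem_image.2 ⟨y, by simpa using hy, by rw [h, Sym2.eq_swap]⟩)
  · intro u v huv
    by_cases hm : s(u, v) ∈ T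
    · obtain ⟨a, ha, h⟩ := mem_image.1 hm
      have ha : a ≠ w := by simpa using ha
      rcases Sym2.eq_iff.1 h with ⟨rfl, h1⟩ | ⟨rfl, h1⟩
      · exact Or.inl ⟨ha, h1⟩
      · exact Or.inr (Or.inl ⟨ha, h1⟩)
    · right; right
      exact Sym2.eq_iff.1 (hmem _ huv hm)

/-! ### Inequalities between edge weights. -/

/-- The decrease `4 ^ α - (4 + k) ^ α` of the weight of an edge. -/
noncomputable def edgeLoss (α k : ℝ) : ℝ := 4 ^ α - (4 + k) ^ α

/-- Dividing by `4 ^ α` turns comparisons of weights into statements about the concave function `t ↦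
t ^ (-α)` near `t = 1`. -/
theorem rpow_div_eq {α a : ℝ} (ha : 0 < a) : a ^ α = 4 ^ α * (4 / a) ^ (-α) := by
  rw [Real.rpow_neg (by positivity), ← Real.inv_rpow (by positivity), inv_div,
    ← Real.mul_rpow (by norm_num) (by positivity)]
  congr 1
  field_simp

theorem edgeLoss_zero (α : ℝ) : edgeLoss α 0 = 0 := by simp [edgeLoss]

theorem edgeLoss_strictMono {α : ℝ} (hα : α < 0) {j k : ℝ} (hj : 0 ≤ j) (h : j < k) :
    edgeLoss α j < edgeLoss α k := by
  have := Real.rpow_lt_rpow_of_neg (x := 4 + j) (y := 4 + k) (by linarith) (by linarith) hα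
  simp only [edgeLoss]
  linarith

theorem edgeLoss_mono {α : ℝ} (hα : α < 0) {j k : ℝ} (hj : 0 ≤ j) (h : j ≤ k) :
    edgeLoss α j ≤ edgeLoss α k := by
  rcases h.eq_or_lt with rfl | h
  · exact le_rfl
  · exact (edgeLoss_strictMono hα hj h).le

theorem edgeLoss_pos {α : ℝ} (hα : α < 0) {k : ℝ} (h : 0 < k) : 0 < edgeLoss α k := by
  have := edgeLoss_strictMono hα le_rfl h
  rwa [edgeLoss_zero] at this

theorem edgeLoss_nonneg {α : ℝ} (hα : α < 0) {k : ℝ} (h : 0 ≤ k) : 0 ≤ edgeLoss α k := by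
  have := edgeLoss_mono hα le_rfl h
  rwa [edgeLoss_zero] at this

theorem concave_rpow_neg {α : ℝ} (h₁ : -1 ≤ α) (h₂ : α < 0) {a b x y : ℝ} (ha : 0 ≤ a)
    (hb : 0 ≤ b) (hab : a + b = 1) (hx : 0 ≤ x) (hy : 0 ≤ y) :
    a * x ^ (-α) + b * y ^ (-α) ≤ (a * x + b * y) ^ (-α) := by
  have hc := Real.concaveOn_rpow (p := -α) (by linarith) (by linarith)
  exact hc.2 hx hy ha hb hab

theorem three_sub_four_le_edgeLoss_two {α : ℝ} (h₁ : -1 ≤ α) (h₂ : α < 0) :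
    (3 : ℝ) ^ α - 4 ^ α ≤ edgeLoss α 2 := by
  -- The points are `4/3` and `4/6`, with mean exactly `1`.
  have := concave_rpow_neg h₁ h₂ (a := 1 / 2) (b := 1 / 2) (x := 4 / 3) (y := 2 / 3) (by norm_num)
    (by norm_num) (by norm_num) (by norm_num) (by norm_num)
  have hp : (0 : ℝ) < 4 ^ α := by positivity
  norm_num at this
  rw [edgeLoss, rpow_div_eq (a := 3) (by norm_num), rpow_div_eq (a := 4 + 2) (by norm_num)]
  norm_num
  nlinarith

theorem three_sub_four_lt_two_mul_edgeLoss_one {α : ℝ} (h₁ : -1 ≤ α) (h₂ : α < 0) :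
    (3 : ℝ) ^ α - 4 ^ α < 2 * edgeLoss α 1 := by
  -- The weighted mean of `4/3` and `4/5` is `44/45 < 1`, whence strictness.
  have := concave_rpow_neg h₁ h₂ (a := 1 / 3) (b := 2 / 3) (x := 4 / 3) (y := 4 / 5) (by norm_num)
    (by norm_num) (by norm_num) (by norm_num) (by norm_num)
  have hp : (0 : ℝ) < 4 ^ α := by positivity
  norm_num at this
  have h3 : ((44 : ℝ) / 45) ^ (-α) < 1 :=
    Real.rpow_lt_one (by norm_num) (by norm_num) (by linarith)
  rw [edgeLoss, rpow_div_eq (a := 3) (by norm_num), rpow_div_eq (a := 4 + 1) (by norm_num)]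
  norm_num
  nlinarith

theorem three_sub_four_lt_edgeLoss_add {α : ℝ} (h₁ : -1 ≤ α) (h₂ : α < 0) :
    (3 : ℝ) ^ α - 4 ^ α < edgeLoss α 1 + edgeLoss α 2 / 2 := by
  -- The points `4/3`, `4/5`, `4/6` carry weights `1 : 1 : 1/2`. Merging the first two at `16/15`
  -- and then adding the third gives the mean `74/75 < 1`.
  have h4 := concave_rpow_neg h₁ h₂ (a := 1 / 2) (b := 1 / 2) (x := 4 / 3) (y := 4 / 5) (by norm_num)
    (by norm_num) (by norm_num) (by norm_num) (by norm_num)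
  have h5 := concave_rpow_neg h₁ h₂ (a := 4 / 5) (b := 1 / 5) (x := 16 / 15) (y := 2 / 3) (by norm_num)
    (by norm_num) (by norm_num) (by norm_num) (by norm_num)
  have hp : (0 : ℝ) < 4 ^ α := by positivity
  norm_num at h4 h5
  have h3 : ((74 : ℝ) / 75) ^ (-α) < 1 :=
    Real.rpow_lt_one (by norm_num) (by norm_num) (by linarith)
  rw [edgeLoss, edgeLoss, rpow_div_eq (a := 3) (by norm_num),
    rpow_div_eq (a := 4 + 1) (by norm_num), rpow_div_eq (a := 4 + 2) (by norm_num)]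
  norm_num
  nlinarith

/-- The drop `t ^ α - (t + s) ^ α` shrinks as `t` grows; here `s = d - 2` and `t` moves from 3 to 4.
Factoring out `3 ^ α` and `4 ^ α` leaves the comparison `(d + 2) / 4 < (d + 1) / 3`. -/
theorem edgeLoss_lt_pendant {α : ℝ} (hα : α < 0) {d : ℝ} (hd : 2 < d) :
    edgeLoss α (d - 2) < 3 ^ α - (d + 1) ^ α := by
  have h3 : (d + 1) ^ α = 3 ^ α * ((d + 1) / 3) ^ α := by
    rw [← Real.mul_rpow (by norm_num) (by linarith)]; congr 1; ring
  have h4 : (4 + (d - 2)) ^ α = 4 ^ α * ((d + 2) / 4) ^ α := by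
    rw [← Real.mul_rpow (by norm_num) (by linarith)]; congr 1; ring
  have h5 : ((d + 1) / 3) ^ α < ((d + 2) / 4) ^ α :=
    Real.rpow_lt_rpow_of_neg (by linarith) (by linarith) hα
  have h6 : ((d + 2) / 4) ^ α < 1 := Real.rpow_lt_one_of_one_lt_of_neg (by linarith) hα
  have h7 : (4 : ℝ) ^ α < 3 ^ α := Real.rpow_lt_rpow_of_neg (by norm_num) (by norm_num) hα
  have h8 : (0 : ℝ) < 4 ^ α := by positivity
  rw [edgeLoss, h3, h4]
  nlinarith

/-- The gain of an edge from a parent of degree `b` to a child of degree `a`, relative to the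
weight `4 ^ α`, when an edge at a pendant child is charged with `3 ^ α - 4 ^ α`. -/
noncomputable def childGain (α : ℝ) (a b : ℕ) : ℝ :=
  ((a : ℝ) + b) ^ α - 4 ^ α - if a = 1 then 3 ^ α - 4 ^ α else 0

/-- Once leaf edges are charged, a child of degree two is the best possible: larger degrees lose by
monotonicity, pendant children by `edgeLoss_lt_pendant`. -/
theorem childGain_le {α : ℝ} (hα : α < 0) {a b : ℕ} (ha : 1 ≤ a) (hb : 2 ≤ b) :
    childGain α a b ≤ -edgeLoss α ((b : ℝ) - 2) := by
  have hb' : (2 : ℝ) ≤ b := by exact_mod_cast hb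
  rw [childGain]
  split_ifs with h
  · subst h
    rcases hb'.eq_or_lt with h2 | h2
    · rw [← h2]; norm_num [edgeLoss]
    · have := edgeLoss_lt_pendant hα h2
      push_cast
      rw [add_comm (1 : ℝ)]
      linarith
  · have ha' : (2 : ℝ) ≤ a := by exact_mod_cast (by omega : 2 ≤ a)
    have := edgeLoss_mono hα (j := (b : ℝ) - 2) (k := a + b - 4) (by linarith) (by linarith)
    simp only [edgeLoss, show (4 : ℝ) + (a + b - 4) = a + b by ring] at this ⊢
    linarith

theorem childGain_of_le_two {α : ℝ} {a : ℕ} (ha : 1 ≤ a) (ha2 : a ≤ 2) :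
    childGain α a 2 = 0 := by
  interval_cases a <;> norm_num [childGain]

/-- The part of the loss at the extra edge, with ends of degrees `a` and `b`, that is credited
to the end of degree `a`. -/
noncomputable def lossShare (α : ℝ) (a b : ℕ) : ℝ :=
  if a ≤ 2 then 0 else if b ≤ 2 then edgeLoss α ((a : ℝ) + b - 4)
    else edgeLoss α ((a : ℝ) + b - 4) / 2

theorem lossShare_add_le {α : ℝ} (hα : α < 0) {a b : ℕ} (ha : 2 ≤ a) (hb : 2 ≤ b) :
    lossShare α a b + lossShare α b a ≤ edgeLoss α ((a : ℝ) + b - 4) := by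
  have ha' : (2 : ℝ) ≤ a := by exact_mod_cast ha
  have hb' : (2 : ℝ) ≤ b := by exact_mod_cast hb
  have := edgeLoss_nonneg hα (k := (a : ℝ) + b - 4) (by linarith)
  rw [lossShare, lossShare, add_comm (b : ℝ)]
  split_ifs <;> linarith

theorem edgeLoss_two_le {α : ℝ} (hα : α < 0) {d : ℕ} (hd : 4 ≤ d) :
    edgeLoss α 2 ≤ edgeLoss α ((d : ℝ) - 2) := by
  have : (4 : ℝ) ≤ d := by exact_mod_cast hd
  exact edgeLoss_mono hα (by norm_num) (by linarith)

/-- For `d ≥ 4` each loss already covers one charge, and there is one loss more than charges. For `d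
= 3` a single charge faces two smaller losses. -/
theorem excess_neg {α : ℝ} (h₁ : -1 ≤ α) (h₂ : α < 0) {d : ℕ} (hd : 3 ≤ d) :
    ((d : ℝ) - 2) * (3 ^ α - 4 ^ α) < ((d : ℝ) - 1) * edgeLoss α ((d : ℝ) - 2) := by
  rcases hd.eq_or_lt with rfl | h4
  · have := three_sub_four_lt_two_mul_edgeLoss_one h₁ h₂
    norm_num at this ⊢
    linarith
  · have h := edgeLoss_two_le h₂ h4
    have h5 := three_sub_four_le_edgeLoss_two h₁ h₂
    have h6 := edgeLoss_pos h₂ (k := 2) (by norm_num)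
    have : (4 : ℝ) ≤ d := by exact_mod_cast h4
    nlinarith

/-- This is the balance at an end of the extra edge, where only `d - 2` children are available. For
`d ≥ 4` they suffice and the share gives strictness; for `d = 3` the share is essential, and halving
it when both ends have degree at least three is still affordable. -/
theorem excess_lt_lossShare {α : ℝ} (h₁ : -1 ≤ α) (h₂ : α < 0) {d b : ℕ} (hd : 3 ≤ d)
    (hb : 2 ≤ b) :
    ((d : ℝ) - 2) * (3 ^ α - 4 ^ α) - ((d : ℝ) - 2) * edgeLoss α ((d : ℝ) - 2)
      < lossShare α d b := by
  have hb' : (2 : ℝ) ≤ b := by exact_mod_cast hb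
  rw [lossShare, if_neg (by omega)]
  rcases hd.eq_or_lt with rfl | h4
  · split_ifs with h
    · obtain rfl : b = 2 := by omega
      have := three_sub_four_lt_two_mul_edgeLoss_one h₁ h₂
      norm_num at this ⊢
      linarith
    · have hb3 : (3 : ℝ) ≤ b := by exact_mod_cast (by omega : 3 ≤ b)
      have := three_sub_four_lt_edgeLoss_add h₁ h₂
      have h6 := edgeLoss_mono h₂ (j := 2) (k := ((3 : ℕ) : ℝ) + b - 4) (by norm_num)
        (by push_cast; linarith)
      norm_num at this h6 ⊢
      linarith
  · have h := edgeLoss_two_le h₂ h4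
    have h5 := three_sub_four_le_edgeLoss_two h₁ h₂
    have hd' : (4 : ℝ) ≤ d := by exact_mod_cast h4
    have h6 := edgeLoss_pos h₂ (k := (d : ℝ) + b - 4) (by linarith)
    split_ifs <;> nlinarith

/-! ### Discharging along a rooting. -/

namespace UnicyclicRooting

variable {V : Type*} [Fintype V] [DecidableEq V] {G : SimpleGraph V} {w : V}

/-- The vertices with parent `u`. -/
def children (R : UnicyclicRooting G w) (u : V) : Finset V :=
  {v | v ≠ w ∧ R.parent v = u}

theorem mem_children {R : UnicyclicRooting G w} {u v : V} :
    v ∈ R.children u ↔ v ≠ w ∧ R.parent v = u := by simp [children]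

theorem adj_of_mem_children {R : UnicyclicRooting G w} {u v : V} (h : v ∈ R.children u) :
    G.Adj u v := by
  obtain ⟨hv, rfl⟩ := mem_children.1 h
  exact (R.adj_parent v hv).symm

theorem sum_children (R : UnicyclicRooting G w) (F : V → ℝ) :
    ∑ v ∈ univ.erase w, F v =
      ∑ v ∈ R.children w, F v + ∑ u ∈ univ.erase w, ∑ v ∈ R.children u, F v := by
  rw [add_sum_erase univ (fun u => ∑ v ∈ R.children u, F v) (mem_univ w),
    ← sum_fiberwise (univ.erase w) R.parent F]
  refine sum_congr rfl fun u _ => sum_congr ?_ fun _ _ => rfl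
  ext v
  simp [mem_children]

theorem parent_notMem_children (R : UnicyclicRooting G w) {u : V} (hu : u ≠ w) :
    R.parent u ∉ R.children u := by
  intro h
  obtain ⟨h1, h2⟩ := mem_children.1 h
  have h3 := R.depth_eq u hu
  have h4 := R.depth_eq _ h1
  rw [h2] at h4
  omega

variable [DecidableRel G.Adj]

theorem children_root (R : UnicyclicRooting G w) : R.children w = G.neighborFinset w := by
  ext v
  rw [SimpleGraph.mem_neighborFinset]
  exact ⟨adj_of_mem_children, fun h => mem_children.2 ⟨h.ne', R.parent_eq_root h⟩⟩

theorem card_children_add_one_le (R : UnicyclicRooting G w) {u : V} (hu : u ≠ w) :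
    #(R.children u) + 1 ≤ G.degree u := by
  rw [← card_insert_of_notMem (R.parent_notMem_children hu), ← G.card_neighborFinset_eq_degree]
  refine card_le_card fun v hv => ?_
  rw [SimpleGraph.mem_neighborFinset]
  rcases mem_insert.1 hv with rfl | hv
  · exact R.adj_parent u hu
  · exact adj_of_mem_children hv

theorem degree_le_of_ne (R : UnicyclicRooting G w) {u : V} (hx : u ≠ R.x)
    (hy : u ≠ R.y) : G.degree u ≤ #(R.children u) + 1 := by
  rw [← G.card_neighborFinset_eq_degree]
  refine (card_le_card (t := insert (R.parent u) (R.children u)) fun v hv => ?_).trans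
    (card_insert_le _ _)
  rw [SimpleGraph.mem_neighborFinset] at hv
  rw [mem_insert, mem_children]
  rcases R.adj_cases u v hv with h | h | h | h
  · exact Or.inl h.2.symm
  · exact Or.inr h
  · exact absurd h.1 hx
  · exact absurd h.1 hy

theorem degree_le (R : UnicyclicRooting G w) (u : V) : G.degree u ≤ #(R.children u) + 2 := by
  rw [← G.card_neighborFinset_eq_degree]
  -- The first element is the partner of `u` on the extra edge. When `u` is neither end it is a
  -- filler, harmless for an upper bound.
  refine (card_le_card (t := insert (if u = R.x then R.y else R.x)
    (insert (R.parent u) (R.children u))) fun v hv => ?_).trans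
    ((card_insert_le _ _).trans (Nat.add_le_add_right (card_insert_le _ _) 1))
  rw [SimpleGraph.mem_neighborFinset] at hv
  rw [mem_insert, mem_insert, mem_children]
  rcases R.adj_cases u v hv with h | h | h | h
  · exact Or.inr (Or.inl h.2.symm)
  · exact Or.inr (Or.inr h)
  · left; rw [if_pos h.1, h.2]
  · left; rw [if_neg (h.1 ▸ R.adj_xy.ne'), h.2]

theorem card_children_add_two_le (R : UnicyclicRooting G w) {u v : V} (hu : u ≠ w)
    (h : G.Adj u v) (hp : R.parent u ≠ v) (hp' : R.parent v ≠ u) :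
    #(R.children u) + 2 ≤ G.degree u := by
  have h1 : v ∉ insert (R.parent u) (R.children u) := by
    rw [mem_insert, mem_children]
    rintro (h | h)
    · exact hp h.symm
    · exact hp' h.2
  rw [show #(R.children u) + 2 = #(R.children u) + 1 + 1 from rfl,
    ← card_insert_of_notMem (R.parent_notMem_children hu), ← card_insert_of_notMem h1,
    ← G.card_neighborFinset_eq_degree]
  refine card_le_card fun v hv => ?_
  rw [SimpleGraph.mem_neighborFinset]
  rcases mem_insert.1 hv with rfl | hv
  · exact h
  rcases mem_insert.1 hv with rfl | hv
  · exact R.adj_parent u hu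
  · exact adj_of_mem_children hv

theorem card_children_x_add_two_le (R : UnicyclicRooting G w) :
    #(R.children R.x) + 2 ≤ G.degree R.x :=
  R.card_children_add_two_le R.x_ne R.adj_xy R.parent_x_ne R.parent_y_ne

theorem card_children_y_add_two_le (R : UnicyclicRooting G w) :
    #(R.children R.y) + 2 ≤ G.degree R.y :=
  R.card_children_add_two_le R.y_ne R.adj_xy.symm R.parent_y_ne R.parent_x_ne

theorem degree_pos (R : UnicyclicRooting G w) (hw : 1 ≤ G.degree w) (u : V) : 1 ≤ G.degree u := by
  by_cases h : u = w
  · rwa [h]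
  · exact le_trans (by omega) (R.card_children_add_one_le h)

/-- The contribution of the vertex `u` to the index, relative to `4 ^ α` per edge. -/
noncomputable def excess (R : UnicyclicRooting G w) (α : ℝ) (u : V) : ℝ :=
  ((G.degree u - 2 : ℕ) : ℝ) * (3 ^ α - 4 ^ α) +
    ∑ v ∈ R.children u, childGain α (G.degree v) (G.degree u)

theorem excess_le_of_card (R : UnicyclicRooting G w) {α : ℝ} (h₂ : α < 0)
    (hw : 1 ≤ G.degree w) {u : V} {m : ℕ} (hm : m ≤ #(R.children u)) (hd : 2 ≤ G.degree u) :
    R.excess α u ≤ ((G.degree u : ℝ) - 2) * (3 ^ α - 4 ^ α)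
      - m * edgeLoss α ((G.degree u : ℝ) - 2) := by
  have hd' : (2 : ℝ) ≤ G.degree u := by exact_mod_cast hd
  have h : ∑ v ∈ R.children u, childGain α (G.degree v) (G.degree u) ≤
      #(R.children u) • (-edgeLoss α ((G.degree u : ℝ) - 2)) :=
    sum_le_card_nsmul _ _ _ fun v _ => childGain_le h₂ (R.degree_pos hw v) hd
  rw [nsmul_eq_mul] at h
  have h3 := edgeLoss_nonneg h₂ (k := (G.degree u : ℝ) - 2) (by linarith)
  have h4 : (m : ℝ) ≤ #(R.children u) := by exact_mod_cast hm
  rw [excess, Nat.cast_sub hd]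
  push_cast
  nlinarith

theorem excess_nonpos (R : UnicyclicRooting G w) {α : ℝ} (h₂ : α < 0)
    (hw : 1 ≤ G.degree w) {u : V} (hu : u ≠ w) (hd : G.degree u ≤ 2) :
    R.excess α u ≤ 0 := by
  rcases hd.eq_or_lt with h | h
  · have := R.excess_le_of_card h₂ hw (m := 0) (u := u) (Nat.zero_le _) h.ge
    rw [h] at this
    norm_num at this
    exact this
  · have := R.card_children_add_one_le hu
    have h0 : R.children u = ∅ := card_eq_zero.1 (by omega)
    rw [excess, h0, Nat.sub_eq_zero_of_le hd]
    simp

theorem excess_eq_zero (R : UnicyclicRooting G w) {α : ℝ}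
    (hw : 1 ≤ G.degree w) (hle : ∀ v, v ≠ w → G.degree v ≤ 2) {u : V} (hu : u ≠ w) :
    R.excess α u = 0 := by
  have hd := hle u hu
  rw [excess, Nat.sub_eq_zero_of_le hd, Nat.cast_zero, zero_mul, zero_add]
  refine sum_eq_zero fun v hv => ?_
  have h1 : 0 < #(R.children u) := card_pos.2 ⟨v, hv⟩
  have h2 := R.card_children_add_one_le hu
  rw [show G.degree u = 2 by omega]
  exact childGain_of_le_two (R.degree_pos hw v) (hle v (mem_children.1 hv).1)

/-- The total contribution of the vertices other than the root and of the extra edge. -/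
noncomputable def remainder (R : UnicyclicRooting G w) (α : ℝ) : ℝ :=
  ∑ u ∈ univ.erase w, R.excess α u - edgeLoss α ((G.degree R.x : ℝ) + G.degree R.y - 4)

theorem remainder_eq_zero (R : UnicyclicRooting G w) {α : ℝ}
    (hw : 1 ≤ G.degree w) (hle : ∀ v, v ≠ w → G.degree v ≤ 2) : R.remainder α = 0 := by
  have hx : G.degree R.x = 2 :=
    le_antisymm (hle _ R.x_ne) (le_trans (by omega) R.card_children_x_add_two_le)
  have hy : G.degree R.y = 2 :=
    le_antisymm (hle _ R.y_ne) (le_trans (by omega) R.card_children_y_add_two_le)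
  rw [remainder, sum_eq_zero fun u hu => R.excess_eq_zero hw hle (by simpa using hu), hx, hy]
  norm_num [edgeLoss_zero]

/-- The local balance: the share of the loss at `xy` is used only at `x` and `y`, the non-root
vertices that can lack a `(d - 1)`-st child. -/
theorem excess_sub_share (R : UnicyclicRooting G w) {α : ℝ} (h₁ : -1 ≤ α) (h₂ : α < 0)
    (hw : 1 ≤ G.degree w) {u : V} (hu : u ≠ w) :
    let t := R.excess α u - (if u = R.x then lossShare α (G.degree R.x) (G.degree R.y) else 0)
      - (if u = R.y then lossShare α (G.degree R.y) (G.degree R.x) else 0)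
    t ≤ 0 ∧ (3 ≤ G.degree u → t < 0) := by
  intro t
  have hx : 2 ≤ G.degree R.x := le_trans (by omega) R.card_children_x_add_two_le
  have hy : 2 ≤ G.degree R.y := le_trans (by omega) R.card_children_y_add_two_le
  have hxy := R.adj_xy.ne
  by_cases hd : G.degree u ≤ 2
  · refine ⟨?_, fun h => by omega⟩
    have h1 := R.excess_nonpos h₂ hw hu hd
    have h2 : (if u = R.x then lossShare α (G.degree R.x) (G.degree R.y) else 0) = 0 := by
      split_ifs with h
      · rw [lossShare, if_pos (h ▸ hd)]
      · rfl
    have h3 : (if u = R.y then lossShare α (G.degree R.y) (G.degree R.x) else 0) = 0 := by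
      split_ifs with h
      · rw [lossShare, if_pos (h ▸ hd)]
      · rfl
    simp only [t, h2, h3]
    linarith
  · suffices h : t < 0 from ⟨h.le, fun _ => h⟩
    push Not at hd
    have hm2 : G.degree u - 2 ≤ #(R.children u) := by have := R.degree_le u; omega
    have he := R.excess_le_of_card h₂ hw hm2 hd.le
    rw [Nat.cast_sub hd.le] at he
    push_cast at he
    by_cases h3 : u = R.x
    · have h5 := excess_lt_lossShare h₁ h₂ (Nat.succ_le_of_lt hd) hy
      have h4 : u ≠ R.y := fun h => hxy (h3 ▸ h)
      simp only [t, if_pos h3, if_neg h4]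
      rw [← h3]
      linarith
    by_cases h4 : u = R.y
    · have h5 := excess_lt_lossShare h₁ h₂ (Nat.succ_le_of_lt hd) hx
      simp only [t, if_neg h3, if_pos h4]
      rw [← h4]
      linarith
    · have hm1 : G.degree u - 1 ≤ #(R.children u) := by have := R.degree_le_of_ne h3 h4; omega
      have he := R.excess_le_of_card h₂ hw hm1 hd.le
      have h5 := excess_neg h₁ h₂ (Nat.succ_le_of_lt hd)
      rw [Nat.cast_sub (by omega)] at he
      push_cast at he
      simp only [t, if_neg h3, if_neg h4]
      linarith

theorem remainder_nonpos (R : UnicyclicRooting G w) {α : ℝ} (h₁ : -1 ≤ α) (h₂ : α < 0)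
    (hw : 1 ≤ G.degree w) :
    R.remainder α ≤ 0 ∧ (R.remainder α = 0 → ∀ v, v ≠ w → G.degree v ≤ 2) := by
  have hx : 2 ≤ G.degree R.x := le_trans (by omega) R.card_children_x_add_two_le
  have hy : 2 ≤ G.degree R.y := le_trans (by omega) R.card_children_y_add_two_le
  have hs := lossShare_add_le h₂ hx hy
  have hsum : ∑ u ∈ univ.erase w, (R.excess α u
      - (if u = R.x then lossShare α (G.degree R.x) (G.degree R.y) else 0)
      - (if u = R.y then lossShare α (G.degree R.y) (G.degree R.x) else 0))
      = ∑ u ∈ univ.erase w, R.excess α u - lossShare α (G.degree R.x) (G.degree R.y)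
        - lossShare α (G.degree R.y) (G.degree R.x) := by
    rw [sum_sub_distrib, sum_sub_distrib, sum_ite_eq', sum_ite_eq',
      if_pos (by simpa using R.x_ne), if_pos (by simpa using R.y_ne)]
  have hle : R.remainder α ≤ ∑ u ∈ univ.erase w, (R.excess α u
      - (if u = R.x then lossShare α (G.degree R.x) (G.degree R.y) else 0)
      - (if u = R.y then lossShare α (G.degree R.y) (G.degree R.x) else 0)) := by
    rw [hsum, remainder]; linarith
  have hterm : ∀ u ∈ univ.erase w, (R.excess α u
      - (if u = R.x then lossShare α (G.degree R.x) (G.degree R.y) else 0)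
      - (if u = R.y then lossShare α (G.degree R.y) (G.degree R.x) else 0)) ≤ 0 :=
    fun u hu => (R.excess_sub_share h₁ h₂ hw (by simpa using hu)).1
  refine ⟨hle.trans (sum_nonpos hterm), fun h v hv => ?_⟩
  by_contra hd
  push Not at hd
  have := sum_lt_sum hterm ⟨v, by simpa using hv, (R.excess_sub_share h₁ h₂ hw hv).2 hd⟩
  rw [sum_const_zero] at this
  linarith

theorem sumConnectivityIndex_eq (R : UnicyclicRooting G w)
    (hE : #G.edgeFinset = Fintype.card V) (α : ℝ) (hw : 2 ≤ G.degree w) :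
    sumConnectivityIndex G α = Fintype.card V * 4 ^ α +
      ((G.degree w : ℝ) - 2) * (3 ^ α - 4 ^ α) +
      ∑ v ∈ G.neighborFinset w, childGain α (G.degree v) (G.degree w) + R.remainder α := by
  have hpos := R.degree_pos (by omega)
  have h1 : sumConnectivityIndex G α = ((G.degree R.x : ℝ) + G.degree R.y) ^ α +
      ∑ v ∈ univ.erase w, ((G.degree v : ℝ) + G.degree (R.parent v)) ^ α := by
    rw [sumConnectivityIndex, R.sum_edgeFinset]
    rfl
  -- Handshake lemma with `|E| = |V|`. The truncated `d - 2` vanishes at leaves, so moving the leaf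
  -- terms across leaves a multiple of `∑ (d(v) - 2) = 0`.
  have h2 : ∑ v, (if G.degree v = 1 then (3 : ℝ) ^ α - 4 ^ α else 0) =
      ∑ v, ((G.degree v - 2 : ℕ) : ℝ) * (3 ^ α - 4 ^ α) := by
    have h3 := G.sum_degrees_eq_twice_card_edges
    have h4 : ∑ v, ((G.degree v : ℝ) - 2) = 0 := by
      rw [sum_sub_distrib, ← Nat.cast_sum, h3, hE]
      simp [mul_comm]
    rw [eq_comm, ← sub_eq_zero, ← sum_sub_distrib]
    refine Eq.trans ?_ ((congrArg (· * ((3 : ℝ) ^ α - 4 ^ α)) h4).trans (zero_mul _))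
    simp only [sum_mul]
    refine sum_congr rfl fun v _ => ?_
    have := hpos v
    split_ifs with h
    · rw [h]; norm_num
    · rw [Nat.cast_sub (by omega)]; push_cast; ring
  have h5 : ∑ v ∈ univ.erase w, ((G.degree v : ℝ) + G.degree (R.parent v)) ^ α =
      ∑ v ∈ univ.erase w, childGain α (G.degree v) (G.degree (R.parent v)) +
      ((Fintype.card V : ℝ) - 1) * 4 ^ α +
      ∑ v, (if G.degree v = 1 then (3 : ℝ) ^ α - 4 ^ α else 0) := by
    rw [← add_sum_erase univ (fun v => if G.degree v = 1 then (3 : ℝ) ^ α - 4 ^ α else 0)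
      (mem_univ w), if_neg (by omega), zero_add]
    have h6 : ((Fintype.card V : ℝ) - 1) * 4 ^ α = ∑ v ∈ univ.erase w, (4 : ℝ) ^ α := by
      rw [sum_const, card_erase_of_mem (mem_univ w), card_univ, nsmul_eq_mul, Nat.cast_sub]
      · simp
      · exact Fintype.card_pos_iff.2 ⟨w⟩
    rw [h6, ← sum_add_distrib, ← sum_add_distrib]
    refine sum_congr rfl fun v _ => ?_
    rw [childGain]; ring
  have h7 : ∀ u, ∑ v ∈ R.children u, childGain α (G.degree v) (G.degree (R.parent v)) =
      ∑ v ∈ R.children u, childGain α (G.degree v) (G.degree u) := fun u =>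
    sum_congr rfl fun v hv => by rw [(mem_children.1 hv).2]
  rw [h1, h5, h2, R.sum_children, h7, R.children_root,
    ← add_sum_erase univ (fun v => ((G.degree v - 2 : ℕ) : ℝ) * ((3 : ℝ) ^ α - 4 ^ α))
      (mem_univ w), remainder, edgeLoss, Nat.cast_sub hw]
  simp only [excess, h7, sum_add_distrib]
  rw [show (4 : ℝ) + (G.degree R.x + G.degree R.y - 4) = G.degree R.x + G.degree R.y by ring]
  push_cast
  ring

end UnicyclicRooting

/-! ### The bound in terms of the pendant neighbours of the root. -/

/-- The number of pendant neighbours of a vertex. -/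
def pendantCount {V : Type*} [Fintype V] (G : SimpleGraph V) [DecidableRel G.Adj]
    (w : V) : ℕ :=
  #{v ∈ G.neighborFinset w | G.degree v = 1}

/-- The value of the index when the vertex of degree `d` has `k` pendant neighbours and no other
vertex has degree more than two. -/
noncomputable def indexBound (α n d k : ℝ) : ℝ :=
  (d - 2 - k) * 3 ^ α + (d - k) * (d + 2) ^ α + k * (d + 1) ^ α + (n - 2 * d + 2 + k) * 4 ^ α

/-- The bound is affine in `k` with slope `4 ^ α - (d + 2) ^ α - (3 ^ α - (d + 1) ^ α)`, negative by
`edgeLoss_lt_pendant`. -/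
theorem indexBound_strictAnti {α : ℝ} (hα : α < 0) {n d j k : ℝ} (hd : 2 < d) (h : j < k) :
    indexBound α n d k < indexBound α n d j := by
  have := edgeLoss_lt_pendant hα hd
  rw [edgeLoss, show (4 : ℝ) + (d - 2) = d + 2 by ring] at this
  simp only [indexBound]
  nlinarith

theorem indexBound_two (α n k : ℝ) : indexBound α n 2 k = indexBound α n 2 0 := by
  norm_num [indexBound]
  ring

namespace UnicyclicRooting

variable {V : Type*} [Fintype V] [DecidableEq V] {G : SimpleGraph V} [DecidableRel G.Adj] {w : V}

theorem sum_childGain_root (R : UnicyclicRooting G w) {α : ℝ} (h₂ : α < 0)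
    (hw : 2 ≤ G.degree w) :
    let t := -(pendantCount G w : ℝ) * (3 ^ α - ((G.degree w : ℝ) + 1) ^ α)
      - ((G.degree w : ℝ) - pendantCount G w) * edgeLoss α ((G.degree w : ℝ) - 2)
    ∑ v ∈ G.neighborFinset w, childGain α (G.degree v) (G.degree w) ≤ t ∧
      ((∀ v, v ≠ w → G.degree v ≤ 2) →
        ∑ v ∈ G.neighborFinset w, childGain α (G.degree v) (G.degree w) = t) := by
  intro t
  have hpos := R.degree_pos (by omega)
  have ht : t = ∑ v ∈ G.neighborFinset w, if G.degree v = 1 then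
      -(3 ^ α - ((G.degree w : ℝ) + 1) ^ α) else -edgeLoss α ((G.degree w : ℝ) - 2) := by
    rw [sum_ite, sum_const, sum_const, nsmul_eq_mul, nsmul_eq_mul]
    have h := card_filter_add_card_filter_not (s := G.neighborFinset w)
      (fun v => G.degree v = 1)
    rw [G.card_neighborFinset_eq_degree] at h
    have h' : (#{v ∈ G.neighborFinset w | ¬G.degree v = 1} : ℝ) =
        (G.degree w : ℝ) - pendantCount G w := by
      rw [pendantCount, ← h]; push_cast; ring
    rw [h']
    simp only [t, pendantCount]
    ring
  have hone : childGain α 1 (G.degree w) = -(3 ^ α - ((G.degree w : ℝ) + 1) ^ α) := by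
    rw [childGain, if_pos rfl, add_comm]; push_cast; ring
  rw [ht]
  constructor
  · refine sum_le_sum fun v _ => ?_
    split_ifs with h
    · rw [h, hone]
    · exact childGain_le h₂ (hpos v) hw
  · intro hle
    refine sum_congr rfl fun v hv => ?_
    have hvw : v ≠ w := by
      rintro rfl
      simp at hv
    split_ifs with h
    · rw [h, hone]
    · have h2 : G.degree v = 2 := by have := hpos v; have := hle v hvw; omega
      rw [h2, childGain, edgeLoss, if_neg (by norm_num)]
      push_cast
      rw [show (4 : ℝ) + (G.degree w - 2) = 2 + G.degree w by ring]
      ring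

theorem sumConnectivityIndex_le (R : UnicyclicRooting G w)
    (hE : #G.edgeFinset = Fintype.card V) {α : ℝ} (h₁ : -1 ≤ α) (h₂ : α < 0)
    (hw : 2 ≤ G.degree w) :
    sumConnectivityIndex G α ≤
        indexBound α (Fintype.card V) (G.degree w) (pendantCount G w) ∧
      (sumConnectivityIndex G α =
          indexBound α (Fintype.card V) (G.degree w) (pendantCount G w) ↔
        ∀ v, v ≠ w → G.degree v ≤ 2) := by
  have h3 := R.sumConnectivityIndex_eq hE α hw
  obtain ⟨h4, h5⟩ := R.sum_childGain_root h₂ hw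
  obtain ⟨h6, h7⟩ := R.remainder_nonpos h₁ h₂ (by omega)
  have h8 : indexBound α (Fintype.card V) (G.degree w) (pendantCount G w) =
      Fintype.card V * 4 ^ α + ((G.degree w : ℝ) - 2) * (3 ^ α - 4 ^ α) +
      (-(pendantCount G w : ℝ) * (3 ^ α - ((G.degree w : ℝ) + 1) ^ α)
      - ((G.degree w : ℝ) - pendantCount G w) * edgeLoss α ((G.degree w : ℝ) - 2)) := by
    rw [indexBound, edgeLoss, show (4 : ℝ) + (G.degree w - 2) = G.degree w + 2 by ring]
    ring
  rw [h3, h8]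
  refine ⟨by linarith, fun h => h7 (by linarith), fun h => ?_⟩
  rw [h5 h, R.remainder_eq_zero (by omega) h, add_zero]

/-- A non-pendant neighbour of `w` other than `x` and `y` has a child, and that child is one of the
`n - 1 - d(w)` vertices outside the closed neighbourhood of `w`. Distinct neighbours have distinct
children, so `d(w) - k ≤ 2 + (n - 1 - d(w))`. -/
theorem two_mul_degree_le (R : UnicyclicRooting G w) :
    2 * G.degree w ≤ Fintype.card V + 1 + pendantCount G w := by
  set N := G.neighborFinset w
  have hN : #N = G.degree w := G.card_neighborFinset_eq_degree w
  have hsub : {v ∈ N | ¬ G.degree v = 1} ⊆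
      {R.x, R.y} ∪ ((univ.erase w) \ N).image R.parent := by
    intro v hv
    obtain ⟨hv, hd⟩ := mem_filter.1 hv
    have hwv : G.Adj w v := by simpa [N] using hv
    rw [mem_union, mem_insert, mem_singleton]
    by_cases hx : v = R.x
    · exact Or.inl (Or.inl hx)
    by_cases hy : v = R.y
    · exact Or.inl (Or.inr hy)
    right
    have h1 := R.degree_le_of_ne hx hy
    have h2 := R.card_children_add_one_le hwv.ne'
    obtain ⟨u, hu⟩ := card_pos.1 (by omega : 0 < #(R.children v))
    obtain ⟨hu1, hu2⟩ := mem_children.1 hu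
    refine mem_image.2 ⟨u, mem_sdiff.2 ⟨by simpa using hu1, fun h => ?_⟩, hu2⟩
    rw [R.parent_eq_root (by simpa [N] using h)] at hu2
    exact hwv.ne hu2
  have h1 := (card_le_card hsub).trans (card_union_le _ _)
  have h2 := card_le_two (a := R.x) (b := R.y)
  have h3 : #(((univ.erase w) \ N).image R.parent) ≤ #((univ.erase w) \ N) := card_image_le
  have h4 : N ⊆ univ.erase w := fun v hv => by
    have hwv : G.Adj w v := by simpa [N] using hv
    simpa using hwv.ne'
  rw [card_sdiff_of_subset h4, hN, card_erase_of_mem (mem_univ w), card_univ] at h3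
  have h5 := card_le_card h4
  rw [hN, card_erase_of_mem (mem_univ w), card_univ] at h5
  have h6 := card_filter_add_card_filter_not (s := N) (fun v => G.degree v = 1)
  rw [hN] at h6
  have h7 : pendantCount G w = #{v ∈ N | G.degree v = 1} := rfl
  have : 0 < Fintype.card V := Fintype.card_pos_iff.2 ⟨w⟩
  omega

end UnicyclicRooting

/-! ### Attaching paths to a cycle -/

section AttachPaths

variable {W ι : Type*} {H : SimpleGraph W} {w : W} {r : ι → ℕ}

theorem SimpleGraph.cycleGraph_degree {l : ℕ} (hl : 3 ≤ l) (a : Fin l)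
    [Fintype ((SimpleGraph.cycleGraph l).neighborSet a)] :
    (SimpleGraph.cycleGraph l).degree a = 2 := by
  obtain ⟨m, rfl⟩ := Nat.exists_eq_add_of_le' hl
  rw [← SimpleGraph.cycleGraph_degree_three_le (v := a)]
  congr!

theorem attachPaths_adj_inl_inl {a b : W} :
    (attachPaths H w r).Adj (.inl a) (.inl b) ↔ H.Adj a b := Iff.rfl

theorem attachPaths_adj_inl_inr {a : W} {q : Σ i, Fin (r i)} :
    (attachPaths H w r).Adj (.inl a) (.inr q) ↔ a = w ∧ (q.2 : ℕ) = 0 := Iff.rfl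

theorem attachPaths_degree_inl_of_ne [Fintype W] [Fintype ι] [DecidableEq W]
    [DecidableRel H.Adj] [DecidableRel (attachPaths H w r).Adj]
    {a : W} (ha : a ≠ w) :
    (attachPaths H w r).degree (.inl a) = H.degree a := by
  rw [← SimpleGraph.card_neighborFinset_eq_degree, ← SimpleGraph.card_neighborFinset_eq_degree,
    ← card_map (s := H.neighborFinset a) (Function.Embedding.inl (β := Σ i, Fin (r i)))]
  congr 1
  ext (b | q)
  · simp [attachPaths_adj_inl_inl]
  · simp [attachPaths_adj_inl_inr, ha]

theorem attachPaths_neighborFinset_inl_self [Fintype W] [Fintype ι] [DecidableEq W]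
    [DecidableRel H.Adj] [DecidableRel (attachPaths H w r).Adj] (hr : ∀ i, 1 ≤ r i) :
    (attachPaths H w r).neighborFinset (.inl w) = (H.neighborFinset w).disjSum
      (univ.map ⟨fun i => ⟨i, ⟨0, hr i⟩⟩, fun _ _ h => congrArg Sigma.fst h⟩) := by
  ext (b | ⟨i, j⟩)
  · simp [attachPaths_adj_inl_inl]
  · simp only [SimpleGraph.mem_neighborFinset, inr_mem_disjSum, mem_map, mem_univ, true_and]
    constructor
    · rintro ⟨-, h⟩
      exact ⟨i, congrArg (Sigma.mk i) (Fin.ext h.symm)⟩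
    · rintro ⟨i', h⟩
      cases h
      exact ⟨rfl, rfl⟩

theorem attachPaths_degree_inl_self [Fintype W] [Fintype ι] [DecidableEq W]
    [DecidableRel H.Adj] [DecidableRel (attachPaths H w r).Adj] (hr : ∀ i, 1 ≤ r i) :
    (attachPaths H w r).degree (.inl w) = H.degree w + Fintype.card ι := by
  rw [← SimpleGraph.card_neighborFinset_eq_degree, attachPaths_neighborFinset_inl_self hr,
    card_disjSum, card_map, SimpleGraph.card_neighborFinset_eq_degree, card_univ]

theorem attachPaths_degree_inr_le [Fintype W] [Fintype ι]
    [DecidableRel (attachPaths H w r).Adj] (q : Σ i, Fin (r i)) :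
    (attachPaths H w r).degree (.inr q) ≤ 2 := by
  classical
  obtain ⟨i, j⟩ := q
  let prev : W ⊕ (Σ i, Fin (r i)) :=
    if h : (j : ℕ) = 0 then .inl w else .inr ⟨i, ⟨j - 1, by omega⟩⟩
  -- At the free end `.inl w` is a filler: the pair only has to contain all neighbours.
  let next : W ⊕ (Σ i, Fin (r i)) :=
    if h : (j : ℕ) + 1 < r i then .inr ⟨i, ⟨j + 1, h⟩⟩ else .inl w
  rw [← SimpleGraph.card_neighborFinset_eq_degree]
  refine (card_le_card (t := {prev, next}) fun v hv => ?_).trans card_le_two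
  rw [SimpleGraph.mem_neighborFinset] at hv
  rw [mem_insert, mem_singleton]
  rcases v with b | ⟨i', j'⟩
  · obtain ⟨rfl, h⟩ := hv
    left; simp only [prev, dif_pos h]
  · obtain ⟨h, h'⟩ := hv
    dsimp only at h h'
    subst h
    rcases h' with h' | h'
    · right
      have : (j : ℕ) + 1 < r i := by omega
      simp only [next, dif_pos this]
      congr 2; exact Fin.ext h'.symm
    · left
      simp only [prev, dif_neg (by omega : ¬ (j : ℕ) = 0)]
      congr 2; exact Fin.ext (by simp only; omega)

theorem attachPaths_degree_inr_zero_eq_one [Fintype W] [Fintype ι]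
    [DecidableRel (attachPaths H w r).Adj] (hr : ∀ i, 1 ≤ r i) (i : ι) :
    (attachPaths H w r).degree (.inr ⟨i, ⟨0, hr i⟩⟩) = 1 ↔ r i = 1 := by
  classical
  have hw : Sum.inl w ∈ (attachPaths H w r).neighborFinset (.inr ⟨i, ⟨0, hr i⟩⟩) := by
    rw [SimpleGraph.mem_neighborFinset]; exact ⟨rfl, rfl⟩
  rw [← SimpleGraph.card_neighborFinset_eq_degree, card_eq_one]
  constructor
  · rintro ⟨a, ha⟩
    by_contra h
    have h2 : 1 < r i := by have := hr i; omega
    have h3 : Sum.inr ⟨i, ⟨1, h2⟩⟩ ∈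
        (attachPaths H w r).neighborFinset (.inr ⟨i, ⟨0, hr i⟩⟩) := by
      rw [SimpleGraph.mem_neighborFinset]; exact ⟨rfl, Or.inl rfl⟩
    rw [ha, mem_singleton] at hw h3
    rw [← hw] at h3
    cases h3
  · intro h
    refine ⟨.inl w, (eq_singleton_iff_unique_mem.2 ⟨hw, fun v hv => ?_⟩)⟩
    rw [SimpleGraph.mem_neighborFinset] at hv
    rcases v with b | ⟨i', j'⟩
    · rw [hv.1]
    · obtain ⟨h1, h2⟩ := hv
      dsimp only at h1 h2
      subst h1
      omega

theorem attachPaths_pendantCount [Fintype W] [Fintype ι] [DecidableEq W]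
    [DecidableRel H.Adj] [DecidableRel (attachPaths H w r).Adj] (hr : ∀ i, 1 ≤ r i)
    (hH : ∀ a, H.degree a = 2) :
    pendantCount (attachPaths H w r) (.inl w) = #{i | r i = 1} := by
  rw [pendantCount, attachPaths_neighborFinset_inl_self hr]
  symm
  refine card_bij (fun i _ => .inr ⟨i, ⟨0, hr i⟩⟩) ?_ ?_ ?_
  · intro i hi
    rw [mem_filter, attachPaths_degree_inr_zero_eq_one hr]
    exact ⟨inr_mem_disjSum.2 (mem_map.2 ⟨i, mem_univ i, rfl⟩), by simpa using hi⟩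
  · intro i _ j _ h
    exact congrArg Sigma.fst (Sum.inr_injective h)
  · rintro (a | q) h
    · rw [mem_filter, inl_mem_disjSum, SimpleGraph.mem_neighborFinset] at h
      rw [attachPaths_degree_inl_of_ne h.1.ne', hH] at h
      exact absurd h.2 (by norm_num)
    · rw [mem_filter, inr_mem_disjSum] at h
      obtain ⟨h1, h2⟩ := h
      obtain ⟨i, -, rfl⟩ := mem_map.1 h1
      exact ⟨i, by simpa using (attachPaths_degree_inr_zero_eq_one hr i).1 h2, rfl⟩

theorem attachPaths_degree_le [Fintype W] [Fintype ι] [DecidableEq W]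
    [DecidableRel H.Adj] [DecidableRel (attachPaths H w r).Adj]
    (hH : ∀ a, H.degree a = 2) {v : W ⊕ (Σ i, Fin (r i))} (hv : v ≠ .inl w) :
    (attachPaths H w r).degree v ≤ 2 := by
  rcases v with a | q
  · rw [attachPaths_degree_inl_of_ne (fun h => hv (congrArg Sum.inl h)), hH]
  · exact attachPaths_degree_inr_le q

end AttachPaths

theorem SimpleGraph.Iso.pendantCount_eq {V W : Type*} [Fintype V] [Fintype W] {G : SimpleGraph V}
    {H : SimpleGraph W} [DecidableRel G.Adj] [DecidableRel H.Adj] (f : G ≃g H) (v : V) :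
    pendantCount H (f v) = pendantCount G v := by
  symm
  refine card_bij (fun u _ => f u) ?_ (fun _ _ _ _ h => f.injective h) ?_
  · intro u hu
    simpa [f.degree_eq, f.map_adj_iff] using hu
  · intro u hu
    obtain ⟨u, rfl⟩ := f.surjective u
    exact ⟨u, by simpa [f.degree_eq, f.map_adj_iff] using hu, rfl⟩

/-! ### Structure when all degrees away from the root are at most two. -/

namespace UnicyclicRooting

variable {V : Type*} {G : SimpleGraph V} {w : V}

/-- The ancestor of `v` that is a child of the root. -/
def branch (R : UnicyclicRooting G w) (v : V) : V := R.parent^[R.depth v - 1] v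

theorem depth_iterate (R : UnicyclicRooting G w) {v : V} :
    ∀ {i : ℕ}, i < R.depth v → R.depth (R.parent^[i] v) = R.depth v - i := by
  intro i
  induction i with
  | zero => simp
  | succ i ih =>
    intro h
    have h1 := ih (by omega)
    have h2 : R.parent^[i] v ≠ w := by
      intro h2; rw [h2, R.depth_root] at h1; omega
    have h3 := R.depth_eq _ h2
    rw [Function.iterate_succ_apply']
    omega

theorem ne_root_of_depth_ne (R : UnicyclicRooting G w) {v : V} (h : R.depth v ≠ 0) : v ≠ w := by
  rintro rfl; exact h R.depth_root

theorem branch_parent (R : UnicyclicRooting G w) {v : V} (hv : v ≠ w) (hp : R.parent v ≠ w) :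
    R.branch (R.parent v) = R.branch v := by
  have h1 := R.depth_eq v hv
  have h2 := R.depth_eq _ hp
  rw [branch, branch, ← Function.iterate_succ_apply, h1, h2]
  rfl

theorem branch_eq_self (R : UnicyclicRooting G w) {v : V} (hv : R.depth v = 1) :
    R.branch v = v := by
  rw [branch, hv]; rfl

theorem branch_iterate (R : UnicyclicRooting G w) {v : V} :
    ∀ {i : ℕ}, i < R.depth v → R.branch (R.parent^[i] v) = R.branch v := by
  intro i
  induction i with
  | zero => simp
  | succ i ih =>
    intro h
    have h1 := R.depth_iterate h
    rw [Function.iterate_succ_apply'] at h1 ⊢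
    have h3 := R.depth_iterate (v := v) (i := i) (by omega)
    have h4 : R.depth (R.parent^[i] v) ≠ 0 := by omega
    have h5 : R.depth (R.parent (R.parent^[i] v)) ≠ 0 := by omega
    rw [R.branch_parent (R.ne_root_of_depth_ne h4) (R.ne_root_of_depth_ne h5), ih (by omega)]

theorem depth_eq_one (R : UnicyclicRooting G w) {v : V} (hv : v ≠ w) (hp : R.parent v = w) :
    R.depth v = 1 := by
  rw [R.depth_eq v hv, hp, R.depth_root]

theorem parent_eq_of_depth_eq_one (R : UnicyclicRooting G w) {v : V} (h : R.depth v = 1) :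
    R.parent v = w := by
  by_contra hp
  have h1 := R.depth_eq v (R.ne_root_of_depth_ne (by omega))
  have h2 := R.depth_ne_zero hp
  omega

variable [Fintype V] [DecidableEq V] [DecidableRel G.Adj]

theorem eq_of_parent_eq (R : UnicyclicRooting G w) (hle : ∀ v, v ≠ w → G.degree v ≤ 2) {u v : V}
    (hu : u ≠ w) (hv : v ≠ w) (h : R.parent u = R.parent v) (hp : R.parent v ≠ w) : u = v := by
  have h1 := R.card_children_add_one_le hp
  have h2 := hle _ hp
  exact card_le_one.1 (by omega : #(R.children (R.parent v)) ≤ 1) u (mem_children.2 ⟨hu, h⟩) v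
    (mem_children.2 ⟨hv, rfl⟩)

/-- A non-root vertex has at most one child, so by induction on depth a branch has at most one
vertex at each level. -/
theorem eq_of_branch_eq (R : UnicyclicRooting G w) (hle : ∀ v, v ≠ w → G.degree v ≤ 2) :
    ∀ {u v : V}, u ≠ w → v ≠ w → R.branch u = R.branch v → R.depth u = R.depth v → u = v := by
  suffices h : ∀ (m : ℕ) (u v : V), R.depth u = m + 1 → R.depth v = m + 1 →
      R.branch u = R.branch v → u = v by
    intro u v hu hv hb hd
    exact h (R.depth v - 1) u v (by have := R.depth_ne_zero hv; omega)
      (by have := R.depth_ne_zero hv; omega) hb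
  intro m
  induction m with
  | zero =>
    intro u v hu hv h
    rwa [R.branch_eq_self hu, R.branch_eq_self hv] at h
  | succ m ih =>
    intro u v hu hv h
    have hu' := R.ne_root_of_depth_ne (v := u) (by omega)
    have hv' := R.ne_root_of_depth_ne (v := v) (by omega)
    have h1 := R.depth_eq u hu'
    have h2 := R.depth_eq v hv'
    have hpu := R.ne_root_of_depth_ne (v := R.parent u) (by omega)
    have hpv := R.ne_root_of_depth_ne (v := R.parent v) (by omega)
    refine R.eq_of_parent_eq hle hu' hv' (ih _ _ (by omega) (by omega) ?_) hpv
    rw [R.branch_parent hu' hpu, R.branch_parent hv' hpv, h]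

/-- If every vertex other than the root has degree at most two, then these vertices fall into
branches, the paths that start at the children of the root. -/
theorem exists_branches (R : UnicyclicRooting G w) (hle : ∀ v, v ≠ w → G.degree v ≤ 2) :
    ∃ (node : {b // b ≠ w ∧ R.parent b = w} → ℕ → V)
      (len : {b // b ≠ w ∧ R.parent b = w} → ℕ),
      (∀ b, 1 ≤ len b) ∧ (∀ b j, j < len b → node b j ≠ w) ∧
      (∀ b, R.parent (node b 0) = w) ∧
      (∀ b j, j + 1 < len b → R.parent (node b (j + 1)) = node b j) ∧
      (∀ v, v ≠ w → ∃ b j, j < len b ∧ node b j = v) ∧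
      (∀ b j b' j', j < len b → j' < len b' → node b j = node b' j' → b = b' ∧ j = j') := by
  -- The deepest vertex of a branch. Its iterated parents run through the whole branch, and `node b
  -- j` will be the one at depth `j + 1`.
  have htip : ∀ b : {b // b ≠ w ∧ R.parent b = w}, ∃ t, (t ≠ w ∧ R.branch t = b) ∧
      ∀ v, v ≠ w → R.branch v = b → R.depth v ≤ R.depth t := by
    rintro ⟨b, hb, hp⟩
    obtain ⟨t, ht, hmax⟩ := exists_max_image ({v | v ≠ w ∧ R.branch v = b} : Finset V) R.depth
      ⟨b, by simpa [hb] using R.branch_eq_self (R.depth_eq_one hb hp)⟩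
    exact ⟨t, by simpa using ht, fun v hv h => hmax v (by simpa [hv] using h)⟩
  choose tip htip hmax using htip
  have hlen : ∀ b, 1 ≤ R.depth (tip b) := fun b =>
    Nat.one_le_iff_ne_zero.2 (R.depth_ne_zero (htip b).1)
  have hd : ∀ b j, j < R.depth (tip b) →
      R.depth (R.parent^[R.depth (tip b) - 1 - j] (tip b)) = j + 1 := fun b j hj => by
    rw [R.depth_iterate (by omega)]; omega
  have hb : ∀ b j, j < R.depth (tip b) →
      R.branch (R.parent^[R.depth (tip b) - 1 - j] (tip b)) = b := fun b j hj => by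
    rw [R.branch_iterate (by omega), (htip b).2]
  have hne : ∀ b j, j < R.depth (tip b) →
      R.parent^[R.depth (tip b) - 1 - j] (tip b) ≠ w := fun b j hj =>
    R.ne_root_of_depth_ne (by rw [hd b j hj]; omega)
  refine ⟨fun b j => R.parent^[R.depth (tip b) - 1 - j] (tip b), fun b => R.depth (tip b),
    hlen, hne, ?_, ?_, ?_, ?_⟩
  · exact fun b => R.parent_eq_of_depth_eq_one (hd b 0 (hlen b))
  · intro b j hj
    dsimp only at hj ⊢
    rw [← Function.iterate_succ_apply' R.parent]
    congr 2
    omega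
  · intro v hv
    have h0 := R.depth_ne_zero hv
    have h1 : R.depth (R.branch v) = 1 := by
      rw [branch, R.depth_iterate (by omega)]; omega
    refine ⟨⟨R.branch v, R.ne_root_of_depth_ne (by omega), R.parent_eq_of_depth_eq_one h1⟩,
      R.depth v - 1, ?_, ?_⟩
    · have := hmax ⟨R.branch v, R.ne_root_of_depth_ne (by omega),
        R.parent_eq_of_depth_eq_one h1⟩ v hv rfl
      dsimp only
      omega
    · have h2 := hmax ⟨R.branch v, R.ne_root_of_depth_ne (by omega),
        R.parent_eq_of_depth_eq_one h1⟩ v hv rfl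
      refine R.eq_of_branch_eq hle (hne _ _ (by omega)) hv (hb _ _ (by omega)) ?_
      rw [hd _ _ (by omega)]
      omega
  · intro b j b' j' hj hj' h
    have h1 := hd b j hj
    have h2 := hb b j hj
    dsimp only at h
    rw [h] at h1 h2
    rw [hd b' j' hj'] at h1
    rw [hb b' j' hj'] at h2
    exact ⟨Subtype.ext h2.symm, by omega⟩

end UnicyclicRooting

theorem SimpleGraph.cycleGraph_adj_iff {l : ℕ} (hl : 2 ≤ l) (u v : Fin l) :
    (SimpleGraph.cycleGraph l).Adj u v ↔ (u : ℕ) + 1 = v ∨ (v : ℕ) + 1 = u ∨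
      ((u : ℕ) = 0 ∧ (v : ℕ) + 1 = l) ∨ ((v : ℕ) = 0 ∧ (u : ℕ) + 1 = l) := by
  rw [SimpleGraph.cycleGraph_adj']
  have hu := u.2
  have hv := v.2
  rcases lt_trichotomy u v with h | rfl | h
  · rw [Fin.sub_val_of_le h.le, Fin.coe_sub_iff_lt.2 h]
    rw [Fin.lt_def] at h
    omega
  · rw [Fin.sub_val_of_le le_rfl]
    omega
  · rw [Fin.sub_val_of_le h.le, Fin.coe_sub_iff_lt.2 h]
    rw [Fin.lt_def] at h
    omega

namespace UnicyclicRooting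

variable {V : Type*} [Fintype V] [DecidableEq V] {G : SimpleGraph V} {w : V} [DecidableRel G.Adj]

/-- The parent and the extra edge use up the degree of `x` and of `y`. Both are therefore childless,
hence the ends of two different branches, and `xy` closes these through `w` to a cycle. The
remaining branches are the attached paths. -/
theorem exists_iso_attachPaths (R : UnicyclicRooting G w) (hle : ∀ v, v ≠ w → G.degree v ≤ 2) :
    ∃ (m : ℕ) (s : Set V) (r : s → ℕ),
      (∀ i, 1 ≤ r i) ∧ ∃ φ : G ≃g attachPaths (SimpleGraph.cycleGraph (m + 3)) 0 r,
        φ w = .inl 0 := by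
  obtain ⟨node, len, hlen, hne, hp0, hps, hsurj, hinj⟩ := R.exists_branches hle
  have hchild : ∀ u, u ≠ w → #(R.children u) = 0 →
      ∃ b, node b (len b - 1) = u := by
    intro u hu h0
    obtain ⟨b, j, hj, rfl⟩ := hsurj u hu
    refine ⟨b, ?_⟩
    congr 1
    by_contra hjl
    have hj1 : j + 1 < len b := by omega
    have h : node b (j + 1) ∈ R.children (node b j) :=
      mem_children.2 ⟨hne _ _ hj1, hps b j hj1⟩
    rw [card_eq_zero.1 h0] at h
    simp at h
  obtain ⟨b₁, hb₁⟩ := hchild R.x R.x_ne (by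
    have := R.card_children_x_add_two_le; have := hle _ R.x_ne; omega)
  obtain ⟨b₂, hb₂⟩ := hchild R.y R.y_ne (by
    have := R.card_children_y_add_two_le; have := hle _ R.y_ne; omega)
  have hb : b₁ ≠ b₂ := by
    rintro rfl
    exact R.adj_xy.ne (hb₁.symm.trans hb₂)
  have hl₁ := hlen b₁
  have hl₂ := hlen b₂
  obtain ⟨m, hm⟩ : ∃ m, m + 3 = 1 + len b₁ + len b₂ := ⟨len b₁ + len b₂ - 2, by omega⟩
  have hadj : ∀ v, v ≠ w → G.Adj v (R.parent v) := R.adj_parent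
  -- From `w` down the first branch to `x` at position `len b₁`, across to `y` at `len b₁ + 1`, and
  -- up the second branch to its top at `len b₁ + len b₂`.
  let cyc : ℕ → V := fun k =>
    if k = 0 then w else if k ≤ len b₁ then node b₁ (k - 1) else node b₂ (len b₁ + len b₂ - k)
  have cyc_zero : cyc 0 = w := if_pos rfl
  have cyc_low : ∀ k, k < len b₁ → cyc (k + 1) = node b₁ k := fun k hk => by
    simp only [cyc, if_neg (Nat.succ_ne_zero k), if_pos (Nat.succ_le_of_lt hk)]
    rfl
  have cyc_high : ∀ k, k < len b₂ → cyc (len b₁ + len b₂ - k) = node b₂ k := fun k hk => by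
    simp only [cyc, if_neg (by omega : ¬ len b₁ + len b₂ - k = 0),
      if_neg (by omega : ¬ len b₁ + len b₂ - k ≤ len b₁)]
    congr 1
    omega
  have cyc_cases : ∀ k, k < m + 3 → k = 0 ∨ (∃ j, j < len b₁ ∧ k = j + 1) ∨
      ∃ j, j < len b₂ ∧ k = len b₁ + len b₂ - j := fun k hk => by
    by_cases h0 : k = 0
    · exact Or.inl h0
    by_cases h1 : k ≤ len b₁
    · exact Or.inr (Or.inl ⟨k - 1, by omega, by omega⟩)
    · exact Or.inr (Or.inr ⟨len b₁ + len b₂ - k, by omega, by omega⟩)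
  have cyc_adj : ∀ k, k + 1 < m + 3 → G.Adj (cyc k) (cyc (k + 1)) := by
    intro k hk
    rcases cyc_cases k (by omega) with rfl | ⟨j, hj, rfl⟩ | ⟨j, hj, rfl⟩
    · rw [cyc_low 0 hl₁, cyc_zero]
      have := hadj _ (hne b₁ 0 hl₁)
      rw [hp0] at this
      exact this.symm
    · rw [cyc_low j hj]
      by_cases hj1 : j + 1 < len b₁
      · rw [cyc_low _ hj1, ← hps _ _ hj1]
        exact (hadj _ (hne _ _ hj1)).symm
      · obtain rfl : j = len b₁ - 1 := by omega
        rw [hb₁, show len b₁ - 1 + 1 + 1 = len b₁ + len b₂ - (len b₂ - 1) by omega,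
          cyc_high _ (by omega), hb₂]
        exact R.adj_xy
    · obtain ⟨i, rfl⟩ : ∃ i, j = i + 1 := ⟨j - 1, by omega⟩
      rw [cyc_high _ hj, show len b₁ + len b₂ - (i + 1) + 1 = len b₁ + len b₂ - i by omega,
        cyc_high i (by omega), ← hps _ _ hj]
      exact hadj _ (hne _ _ hj)
  have cyc_close : G.Adj (cyc 0) (cyc (len b₁ + len b₂)) := by
    have h := cyc_high 0 (by omega)
    rw [Nat.sub_zero] at h
    rw [h, cyc_zero]
    have := hadj _ (hne b₂ 0 hl₂)
    rw [hp0] at this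
    exact this.symm
  have cyc_mem : ∀ k, k < m + 3 → cyc k = w ∨ ∃ b j, (b = b₁ ∨ b = b₂) ∧ j < len b ∧
      cyc k = node b j := by
    intro k hk
    rcases cyc_cases k hk with rfl | ⟨j, hj, rfl⟩ | ⟨j, hj, rfl⟩
    · exact Or.inl cyc_zero
    · exact Or.inr ⟨b₁, j, Or.inl rfl, hj, cyc_low j hj⟩
    · exact Or.inr ⟨b₂, j, Or.inr rfl, hj, cyc_high j hj⟩
  have cyc_inj : ∀ k k', k < m + 3 → k' < m + 3 → cyc k = cyc k' → k = k' := by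
    intro k k' hk hk' h
    rcases cyc_cases k hk with rfl | ⟨j, hj, rfl⟩ | ⟨j, hj, rfl⟩ <;>
    rcases cyc_cases k' hk' with rfl | ⟨j', hj', rfl⟩ | ⟨j', hj', rfl⟩
    · rfl
    · rw [cyc_zero, cyc_low _ hj'] at h
      exact absurd h.symm (hne _ _ hj')
    · rw [cyc_zero, cyc_high _ hj'] at h
      exact absurd h.symm (hne _ _ hj')
    · rw [cyc_low _ hj, cyc_zero] at h
      exact absurd h (hne _ _ hj)
    · rw [cyc_low _ hj, cyc_low _ hj'] at h
      rw [(hinj _ _ _ _ hj hj' h).2]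
    · rw [cyc_low _ hj, cyc_high _ hj'] at h
      exact absurd (hinj _ _ _ _ hj hj' h).1 hb
    · rw [cyc_high _ hj, cyc_zero] at h
      exact absurd h (hne _ _ hj)
    · rw [cyc_high _ hj, cyc_low _ hj'] at h
      exact absurd (hinj _ _ _ _ hj hj' h).1 hb.symm
    · rw [cyc_high _ hj, cyc_high _ hj'] at h
      rw [(hinj _ _ _ _ hj hj' h).2]
  let s : Set V := {v | (v ≠ w ∧ R.parent v = w) ∧ v ≠ b₁ ∧ v ≠ b₂}
  let toB : s → {b // b ≠ w ∧ R.parent b = w} := fun i => ⟨i.1, i.2.1⟩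
  have toB_inj : ∀ i i', toB i = toB i' → i = i' := fun i i' h =>
    Subtype.ext (by injection h)
  have toB_ne : ∀ i, toB i ≠ b₁ ∧ toB i ≠ b₂ := fun i =>
    ⟨fun h => i.2.2.1 (congrArg Subtype.val h), fun h => i.2.2.2 (congrArg Subtype.val h)⟩
  let f : Fin (m + 3) ⊕ (Σ i : s, Fin (len (toB i))) → V :=
    Sum.elim (fun k => cyc k) (fun q => node (toB q.1) q.2)
  have f_inj : Function.Injective f := by
    rintro (k | ⟨i, j⟩) (k' | ⟨i', j'⟩) h
    · exact congrArg Sum.inl (Fin.ext (cyc_inj _ _ k.2 k'.2 h))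
    · change cyc k = node (toB i') j' at h
      rcases cyc_mem k k.2 with h1 | ⟨b, n, h1, hn, h2⟩
      · exact absurd (h.symm.trans h1) (hne _ _ j'.2)
      · have := (hinj _ _ _ _ hn j'.2 (h2.symm.trans h)).1
        rcases h1 with rfl | rfl
        · exact absurd this.symm (toB_ne i').1
        · exact absurd this.symm (toB_ne i').2
    · change node (toB i) j = cyc k' at h
      rcases cyc_mem k' k'.2 with h1 | ⟨b, n, h1, hn, h2⟩
      · exact absurd (h.trans h1) (hne _ _ j.2)
      · have := (hinj _ _ _ _ hn j.2 (h2.symm.trans h.symm)).1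
        rcases h1 with rfl | rfl
        · exact absurd this.symm (toB_ne i).1
        · exact absurd this.symm (toB_ne i).2
    · obtain ⟨h1, h2⟩ := hinj _ _ _ _ j.2 j'.2 h
      obtain rfl := toB_inj _ _ h1
      rw [Fin.ext h2]
  have f_surj : Function.Surjective f := by
    intro v
    by_cases hv : v = w
    · exact ⟨.inl 0, by rw [hv]; exact cyc_zero⟩
    obtain ⟨b, j, hj, rfl⟩ := hsurj v hv
    by_cases h1 : b = b₁
    · subst h1
      exact ⟨.inl ⟨j + 1, by omega⟩, cyc_low j hj⟩
    by_cases h2 : b = b₂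
    · subst h2
      exact ⟨.inl ⟨len b₁ + len b - j, by omega⟩, cyc_high j hj⟩
    · exact ⟨.inr ⟨⟨b.1, b.2, fun h => h1 (Subtype.ext h), fun h => h2 (Subtype.ext h)⟩, ⟨j, hj⟩⟩,
        rfl⟩
  set H := attachPaths (SimpleGraph.cycleGraph (m + 3)) 0 (fun i => len (toB i)) with hH
  have cadj := SimpleGraph.cycleGraph_adj_iff (l := m + 3) (by omega)
  have f_parent : ∀ a, f a ≠ w → ∃ a', f a' = R.parent (f a) ∧ H.Adj a a' := by
    rintro (k | ⟨i, j⟩) ha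
    · change cyc k ≠ w at ha
      rcases cyc_cases k k.2 with h | ⟨j, hj, h⟩ | ⟨j, hj, h⟩
      · rw [h] at ha; exact absurd cyc_zero ha
      · rcases j with _ | j
        · refine ⟨.inl 0, ?_, (cadj _ _).2 ?_⟩
          · change cyc 0 = R.parent (cyc k)
            rw [h, cyc_low _ hj, hp0, cyc_zero]
          · simp [h]
        · refine ⟨.inl ⟨j + 1, by omega⟩, ?_, (cadj _ _).2 ?_⟩
          · change cyc (j + 1) = R.parent (cyc k)
            rw [h, cyc_low _ hj, hps _ _ hj, cyc_low _ (by omega)]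
          · simp [h]
      · rcases j with _ | j
        · refine ⟨.inl 0, ?_, (cadj _ _).2 ?_⟩
          · change cyc 0 = R.parent (cyc k)
            rw [h, cyc_high _ hj, hp0, cyc_zero]
          · right; right; right
            exact ⟨rfl, by omega⟩
        · refine ⟨.inl ⟨len b₁ + len b₂ - j, by omega⟩, ?_, (cadj _ _).2 ?_⟩
          · change cyc (len b₁ + len b₂ - j) = R.parent (cyc k)
            rw [h, cyc_high _ hj, hps _ _ hj, cyc_high _ (by omega)]
          · left
            simp only [h]
            omega
    · obtain ⟨j, hj⟩ := j
      rcases j with _ | j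
      · exact ⟨.inl 0, cyc_zero.trans (hp0 _).symm, rfl, rfl⟩
      · exact ⟨.inr ⟨i, ⟨j, by omega⟩⟩, (hps _ _ hj).symm, rfl, Or.inr rfl⟩
  have f_x : f (.inl ⟨len b₁, by omega⟩) = R.x := by
    have := cyc_low (len b₁ - 1) (by omega)
    rw [Nat.sub_add_cancel hl₁, hb₁] at this
    exact this
  have f_y : f (.inl ⟨len b₁ + 1, by omega⟩) = R.y := by
    have := cyc_high (len b₂ - 1) (by omega)
    rw [show len b₁ + len b₂ - (len b₂ - 1) = len b₁ + 1 by omega, hb₂] at this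
    exact this
  have f_adj : ∀ a b, G.Adj (f a) (f b) ↔ H.Adj a b := by
    intro a b
    constructor
    · intro h
      rcases R.adj_cases _ _ h with ⟨h1, h2⟩ | ⟨h1, h2⟩ | ⟨h1, h2⟩ | ⟨h1, h2⟩
      · obtain ⟨a', h3, h4⟩ := f_parent a h1
        rwa [f_inj (h3.trans h2)] at h4
      · obtain ⟨a', h3, h4⟩ := f_parent b h1
        rw [f_inj (h3.trans h2)] at h4
        exact h4.symm
      · rw [f_inj (h1.trans f_x.symm), f_inj (h2.trans f_y.symm)]
        exact (cadj _ _).2 (Or.inl rfl)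
      · rw [f_inj (h1.trans f_y.symm), f_inj (h2.trans f_x.symm)]
        exact (cadj _ _).2 (Or.inr (Or.inl rfl))
    · have root_adj : ∀ b, G.Adj w (node b 0) := fun b => by
        have := hadj _ (hne b 0 (hlen b))
        rw [hp0] at this
        exact this.symm
      have node_adj : ∀ b (j j' : Fin (len b)), (j : ℕ) + 1 = j' →
          G.Adj (node b j) (node b j') := fun b j j' h => by
        have := hps b j (by omega)
        rw [← h, ← this]
        exact (hadj _ (hne _ _ (by omega))).symm
      rcases a with k | ⟨i, j⟩ <;> rcases b with k' | ⟨i', j'⟩ <;> intro h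
      · change G.Adj (cyc k) (cyc k')
        rcases (cadj _ _).1 h with h | h | ⟨h, h'⟩ | ⟨h, h'⟩
        · rw [← h]; exact cyc_adj _ (by omega)
        · rw [← h]; exact (cyc_adj _ (by omega)).symm
        · rw [h, show (k' : ℕ) = len b₁ + len b₂ by omega]; exact cyc_close
        · rw [h, show (k : ℕ) = len b₁ + len b₂ by omega]; exact cyc_close.symm
      · obtain ⟨rfl, h⟩ := h
        change G.Adj (cyc 0) (node (toB i') j')
        dsimp only at h
        rw [cyc_zero, h]
        exact root_adj _
      · obtain ⟨rfl, h⟩ := h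
        change G.Adj (node (toB i) j) (cyc 0)
        dsimp only at h
        rw [cyc_zero, h]
        exact (root_adj _).symm
      · obtain ⟨h1, h2⟩ := h
        dsimp only at h1 h2
        subst h1
        rcases h2 with h2 | h2
        · exact node_adj _ _ _ h2
        · exact (node_adj _ _ _ h2).symm
  let φ : H ≃g G := ⟨Equiv.ofBijective f ⟨f_inj, f_surj⟩, f_adj _ _⟩
  refine ⟨m, s, fun i => len (toB i), fun i => hlen _, φ.symm, ?_⟩
  rw [RelIso.symm_apply_eq]
  exact cyc_zero.symm

end UnicyclicRooting

/-! ### Recognising and evaluating the extremal graphs. -/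

/-- Attached paths may be indexed by any type of the right size. -/
def attachPathsCongr {W ι ι' : Type*} (H : SimpleGraph W) (w : W) {r : ι → ℕ} {r' : ι' → ℕ}
    (e : ι ≃ ι') (h : ∀ i, r i = r' (e i)) : attachPaths H w r ≃g attachPaths H w r' where
  toEquiv := Equiv.sumCongr (Equiv.refl W) (Equiv.sigmaCongr e fun i => finCongr (h i))
  map_rel_iff' := by
    rintro (a | q) (b | q')
    · exact Iff.rfl
    · exact Iff.rfl
    · exact Iff.rfl
    · exact and_congr e.injective.eq_iff Iff.rfl

section

variable {V : Type*} [Fintype V] {G : SimpleGraph V} {ι : Type*} [Fintype ι] {r : ι → ℕ} {l : ℕ}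
  {c : Fin l}

theorem card_eq_of_iso_attachPaths (φ : G ≃g attachPaths (SimpleGraph.cycleGraph l) c r) :
    Fintype.card V = l + ∑ i, r i := by
  rw [Fintype.card_congr φ.toEquiv]
  simp

variable [DecidableRel G.Adj]

theorem degree_eq_of_iso_attachPaths (hl : 3 ≤ l) (hr : ∀ i, 1 ≤ r i)
    (φ : G ≃g attachPaths (SimpleGraph.cycleGraph l) c r) {w : V} (hw : φ w = .inl c) :
    G.degree w = 2 + Fintype.card ι ∧ pendantCount G w = #{i | r i = 1} ∧
      ∀ v, v ≠ w → G.degree v ≤ 2 := by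
  classical
  have hH : ∀ a, (SimpleGraph.cycleGraph l).degree a = 2 := fun a =>
    SimpleGraph.cycleGraph_degree hl a
  refine ⟨?_, ?_, fun v hv => ?_⟩
  · rw [← φ.degree_eq, hw, attachPaths_degree_inl_self hr, hH]
  · rw [← φ.pendantCount_eq, hw, attachPaths_pendantCount hr hH]
  · rw [← φ.degree_eq]
    exact attachPaths_degree_le hH fun h => hv (φ.injective (h.trans hw.symm))

theorem IsUnicyclic.sumConnectivityIndex_eq_of_iso [DecidableEq V] (hG : IsUnicyclic G) {α : ℝ} (h₁ : -1 ≤ α)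
    (h₂ : α < 0) (hl : 3 ≤ l) (hr : ∀ i, 1 ≤ r i)
    (φ : G ≃g attachPaths (SimpleGraph.cycleGraph l) c r) :
    sumConnectivityIndex G α = indexBound α (Fintype.card V) ((2 + Fintype.card ι : ℕ) : ℝ)
      (#{i | r i = 1} : ℕ) := by
  obtain ⟨w, hw⟩ := φ.surjective (.inl c)
  obtain ⟨hd, hp, hle⟩ := degree_eq_of_iso_attachPaths hl hr φ hw
  obtain ⟨R⟩ := exists_unicyclicRooting hG.1 hG.card_edgeFinset w
  rw [← hd, ← hp]
  exact (R.sumConnectivityIndex_le hG.card_edgeFinset h₁ h₂ (by omega)).2.2 hle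

end

theorem indexBound_natCast {α n : ℝ} (hα : α < 0) {d : ℕ} (hd : 2 ≤ d) {j k : ℝ} (h : j ≤ k) :
    indexBound α n d k ≤ indexBound α n d j := by
  rcases h.eq_or_lt with rfl | h
  · exact le_rfl
  rcases hd.eq_or_lt with rfl | hd
  · push_cast
    rw [indexBound_two, indexBound_two α n j]
  · exact (indexBound_strictAnti hα (by exact_mod_cast hd) h).le

/-- Counting each pendant path twice, every path counts at least 2. The minimal number of pendant
neighbours leaves no slack, which forces the cycle to be a triangle and every other path to have
exactly two new vertices. -/
theorem nonempty_iso_extremalU {V ι : Type*} [Fintype V] [Fintype ι] {G : SimpleGraph V}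
    {m : ℕ} {r : ι → ℕ} (hr : ∀ i, 1 ≤ r i)
    (φ : G ≃g attachPaths (SimpleGraph.cycleGraph (m + 3)) 0 r) {n Δ : ℕ}
    (hn : n = m + 3 + ∑ i, r i) (hΔ : Δ = 2 + Fintype.card ι)
    (hk : 2 * Δ = n + 1 + #{i | r i = 1}) : Nonempty (G ≃g extremalU n Δ) := by
  classical
  have h1 : ∀ i, 2 ≤ r i + if r i = 1 then 1 else 0 := fun i => by
    have := hr i
    split_ifs <;> omega
  have h2 : ∑ i, (r i + if r i = 1 then 1 else 0) = ∑ i, r i + #{i | r i = 1} := by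
    rw [sum_add_distrib, card_filter]
  have h3 : ∑ _i : ι, 2 = Fintype.card ι * 2 := by simp
  have h4 : ∑ _i : ι, 2 ≤ ∑ i, (r i + if r i = 1 then 1 else 0) := sum_le_sum fun i _ => h1 i
  obtain rfl : m = 0 := by omega
  have h5 : ∀ i, ¬ r i = 1 → r i = 2 := fun i hi => by
    have := (sum_eq_sum_iff_of_le fun i _ => h1 i).1 (by omega) i (mem_univ i)
    rw [if_neg hi] at this
    omega
  have h6 := card_filter_add_card_filter_not (s := (univ : Finset ι)) (fun i => r i = 1)
  rw [card_univ] at h6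
  let e₁ : {i // r i = 1} ≃ Fin (2 * Δ - n - 1) :=
    Fintype.equivFinOfCardEq (by rw [Fintype.card_subtype]; omega)
  let e₂ : {i // ¬ r i = 1} ≃ Fin (n - Δ - 1) :=
    Fintype.equivFinOfCardEq (by rw [Fintype.card_subtype]; omega)
  let e : ι ≃ Fin (2 * Δ - n - 1) ⊕ Fin (n - Δ - 1) :=
    (Equiv.sumCompl fun i => r i = 1).symm.trans (Equiv.sumCongr e₁ e₂)
  refine ⟨φ.trans (attachPathsCongr _ _ e fun i => ?_)⟩
  by_cases h : r i = 1
  · simp [e, h, Equiv.sumCompl_symm_apply_of_pos]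
  · simp [e, Equiv.sumCompl_symm_apply_of_neg, h5 i h]

theorem theorem2p2 {V : Type*} [Fintype V] [DecidableEq V]
    (G : SimpleGraph V) [DecidableRel G.Adj] (n Δ : ℕ) (α : ℝ)
    (hG : IsUnicyclic G) (hn : Fintype.card V = n) (hΔ : G.maxDegree = Δ)
    (hα₁ : -1 ≤ α) (hα₂ : α < 0) :
    (((n : ℝ) + 2) / 2 ≤ (Δ : ℝ) → (Δ : ℝ) ≤ (n : ℝ) - 1 →
      sumConnectivityIndex G α ≤
          ((n : ℝ) - Δ - 1) * (3 : ℝ) ^ α + ((n : ℝ) - Δ + 1) * ((Δ : ℝ) + 2) ^ α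
            + (2 * (Δ : ℝ) - n - 1) * ((Δ : ℝ) + 1) ^ α + (4 : ℝ) ^ α ∧
      (sumConnectivityIndex G α =
          ((n : ℝ) - Δ - 1) * (3 : ℝ) ^ α + ((n : ℝ) - Δ + 1) * ((Δ : ℝ) + 2) ^ α
            + (2 * (Δ : ℝ) - n - 1) * ((Δ : ℝ) + 1) ^ α + (4 : ℝ) ^ α ↔
        Nonempty (G ≃g extremalU n Δ))) ∧
    (2 ≤ Δ → (Δ : ℝ) ≤ ((n : ℝ) + 1) / 2 →
      sumConnectivityIndex G α ≤
          ((Δ : ℝ) - 2) * (3 : ℝ) ^ α + (Δ : ℝ) * ((Δ : ℝ) + 2) ^ α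
            + ((n : ℝ) - 2 * Δ + 2) * (4 : ℝ) ^ α ∧
      (sumConnectivityIndex G α =
          ((Δ : ℝ) - 2) * (3 : ℝ) ^ α + (Δ : ℝ) * ((Δ : ℝ) + 2) ^ α
            + ((n : ℝ) - 2 * Δ + 2) * (4 : ℝ) ^ α ↔
        IsCycleWithLongPaths G (Δ - 2))) := by
  classical
  have hE := hG.card_edgeFinset
  have := hG.1.nonempty
  obtain ⟨w, hw⟩ := G.exists_maximal_degree_vertex
  rw [hΔ] at hw
  obtain ⟨R⟩ := exists_unicyclicRooting hG.1 hE w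
  have hbound := fun h => R.sumConnectivityIndex_le hE hα₁ hα₂ h
  have hk := R.two_mul_degree_le
  rw [← hw, hn] at hbound hk
  have hstruct := R.exists_iso_attachPaths
  set k := pendantCount G w with hk_def
  have hk' : 2 * (Δ : ℝ) ≤ n + 1 + k := by exact_mod_cast hk
  constructor
  · intro hΔ₁ hΔ₂
    have hΔn : n + 2 ≤ 2 * Δ := by
      have : (n : ℝ) + 2 ≤ 2 * Δ := by linarith
      exact_mod_cast this
    have hΔn' : Δ + 1 ≤ n := by
      have : (Δ : ℝ) + 1 ≤ n := by linarith
      exact_mod_cast this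
    have hval : ((n : ℝ) - Δ - 1) * (3 : ℝ) ^ α + ((n : ℝ) - Δ + 1) * ((Δ : ℝ) + 2) ^ α
            + (2 * (Δ : ℝ) - n - 1) * ((Δ : ℝ) + 1) ^ α + (4 : ℝ) ^ α =
        indexBound α n Δ (2 * Δ - n - 1) := by
      rw [indexBound]; ring
    rw [hval]
    obtain ⟨hle, heq⟩ := hbound (by omega)
    refine ⟨hle.trans (indexBound_natCast hα₂ (by omega) (by linarith)), fun h => ?_, ?_⟩
    · have hkeq : (k : ℝ) = 2 * Δ - n - 1 := by
        by_contra hne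
        have := indexBound_strictAnti hα₂ (n := n) (d := Δ) (j := 2 * Δ - n - 1) (k := k)
          (by exact_mod_cast (by omega : 2 < Δ)) (lt_of_le_of_ne (by linarith) (Ne.symm hne))
        linarith
      rw [← hkeq] at h
      obtain ⟨m, s, r, hr, φ, hφ⟩ := hstruct (heq.1 h)
      obtain ⟨hd, hp, -⟩ := degree_eq_of_iso_attachPaths (by omega) hr φ hφ
      have hcard := card_eq_of_iso_attachPaths φ
      refine nonempty_iso_extremalU hr φ (hn.symm.trans hcard) (hw.trans hd) ?_
      rw [← hp, ← hk_def]
      have : 2 * (Δ : ℝ) = n + 1 + k := by linarith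
      exact_mod_cast this
    · rintro ⟨φ⟩
      have h := hG.sumConnectivityIndex_eq_of_iso hα₁ hα₂ le_rfl
        (by rintro (i | i) <;> simp) φ
      rw [h, hn]
      have h1 : 2 + Fintype.card (Fin (2 * Δ - n - 1) ⊕ Fin (n - Δ - 1)) = Δ := by
        rw [Fintype.card_sum, Fintype.card_fin, Fintype.card_fin]; omega
      have h2 : #{i : Fin (2 * Δ - n - 1) ⊕ Fin (n - Δ - 1) |
          Sum.elim (fun _ => 1) (fun _ => 2) i = 1} = 2 * Δ - n - 1 := by
        rw [card_filter, Fintype.sum_sum_type]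
        simp
      rw [h1, h2, Nat.sub_sub, Nat.cast_sub (by omega)]
      congr 1
      push_cast
      ring
  · intro hΔ₁ _
    have hval : ((Δ : ℝ) - 2) * (3 : ℝ) ^ α + (Δ : ℝ) * ((Δ : ℝ) + 2) ^ α
            + ((n : ℝ) - 2 * Δ + 2) * (4 : ℝ) ^ α = indexBound α n Δ 0 := by
      rw [indexBound]; ring
    rw [hval]
    obtain ⟨hle, heq⟩ := hbound hΔ₁
    refine ⟨hle.trans (indexBound_natCast hα₂ hΔ₁ k.cast_nonneg), fun h => ?_, ?_⟩
    -- Strict monotonicity in `k` fails at `Δ = 2`, where `indexBound` is constant in `k`. There no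
    -- path is attached, so the length condition is vacuous.
    · have hkeq : Δ = 2 ∨ k = 0 := by
        by_contra! hne
        have := indexBound_strictAnti hα₂ (n := n) (d := Δ) (j := 0) (k := k)
          (by exact_mod_cast (by omega : 2 < Δ)) (by exact_mod_cast Nat.pos_of_ne_zero hne.2)
        linarith
      have hb : indexBound α n Δ 0 = indexBound α n Δ k := by
        rcases hkeq with h2 | h0
        · rw [h2]; push_cast; rw [indexBound_two α n k]
        · rw [h0, Nat.cast_zero]
      obtain ⟨m, s, r, hr, φ, hφ⟩ := hstruct (heq.1 (h.trans hb))
      obtain ⟨hd, hp, -⟩ := degree_eq_of_iso_attachPaths (by omega) hr φ hφ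
      let e : s ≃ Fin (Δ - 2) := Fintype.equivFinOfCardEq (by omega)
      refine ⟨m + 3, by omega, 0, r ∘ e.symm, fun i => ?_,
        ⟨φ.trans (attachPathsCongr _ _ e fun i => by simp)⟩⟩
      have hk0 : k = 0 := by
        rcases hkeq with h2 | h0
        · exact absurd i.2 (by omega)
        · exact h0
      have h1 : r (e.symm i) ≠ 1 := fun h1 => by
        have : 0 < #{i | r i = 1} := card_pos.2 ⟨e.symm i, by simpa using h1⟩
        omega
      have h2 := hr (e.symm i)
      simp only [Function.comp_apply]
      omega
    · rintro ⟨l, hl, c, r, hr, ⟨φ⟩⟩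
      have h := hG.sumConnectivityIndex_eq_of_iso hα₁ hα₂ hl (fun i => by have := hr i; omega) φ
      rw [h, hn]
      have h2 : #{i | r i = 1} = 0 := by
        rw [card_eq_zero, filter_eq_empty_iff]
        intro i _
        have := hr i
        omega
      rw [h2, Fintype.card_fin, Nat.add_sub_cancel' hΔ₁, Nat.cast_zero]
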